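/- An instance of the min latency set cover problem consists of $n$ vertices and a finite collection $E$ of nonempty subsets (hyperedges) of the vertex set. For an ordering $\sigma$ of the vertices, in which one vertex is scheduled at each of the times $1,\dots,n$, the cover time $\mathrm{Cov}_\sigma(e)$ of $e\in E$ is the earliest time by which all $k_e=|e|$ vertices of $e$ have been scheduled; the cost of $\sigma$ is $\sum_{e\in E}\mathrm{Cov}_\sigma(e)$, and $\mathrm{OPT}$ is the minimum cost over all orderings. **Theorem.** (i) There is a $2$-approximation algorithm for min latency set cover: an algorithm which on every instance runs in time polynomial in $n+|E|$ and outputs an ordering of cost at most $2\,\mathrm{OPT}$. (ii) The following LP-rounding algorithm attains this ratio in expectation for $\alpha=2$. Consider the linear program in the variables $x_{v,t},u_{e,t}\ge 0$ ($t=1,2,\dots$) $$\min\sum_{e,t}u_{e,t}\quad\text{s.t.}\quad \sum_v x_{v,t}\le 1\ \ \forall t,\qquad (k_e-|S|)\,u_{e,t}+\sum_{v\in e\setminus S}\ \sum_{t'<t}x_{v,t'}\ \ge\ k_e-|S|\quad \forall e,t,\ S\subseteq e,\ |S|<k_e,$$ where $k_e=|e|$. It has an optimal solution. Let $\alpha\ge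 2$, let $(x,u)$ be any optimal solution, let $K(t,t')=\frac{\alpha t'}{t(t+1)}$ for $1\le t'\le t$ and $K(t,t')=0$ otherwise, and put $z_{v,t}=\sum_{t'}K(t,t')x_{v,t'}$. Draw thresholds $\alpha_v$ independently and uniformly from $[0,1]$, let $\tau_v\in\{1,2,\dots\}\cup\{\infty\}$ be the earliest time $t$ with $\sum_{t'<t}z_{v,t'}\ge\alpha_v$ ($\infty$ if there is none), and let $\sigma$ be the ordering of the vertices by increasing $\tau_v$, with ties broken uniformly at random. Then $$\mathbb E\Big[\sum_{e\in E}\mathrm{Cov}_\sigma(e)\Big]\ \le\ \frac{\alpha^2}{2(\alpha-1)}\,\mathrm{OPT},$$ and for $\alpha=2$ the right-hand side is $2\,\mathrm{OPT}$. -/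

import Mathlib

open Finset MeasureTheory
open scoped Nat

noncomputable section

/-- An instance of generalized min sum set cover (GMSSC): the vertices are `Fin n`, the collection
of hyperedges is the family `edge` (repetitions are allowed), and hyperedge `j` has the cover
requirement `demand j`, with `1 ≤ demand j ≤ |edge j|`. -/
structure GMSSC where
  n : ℕ
  m : ℕ
  edge : Fin m → Finset (Fin n)
  demand : Fin m → ℕ
  demand_pos : ∀ j, 1 ≤ demand j
  demand_le : ∀ j, demand j ≤ #(edge j)

namespace GMSSC

variable (I : GMSSC)

/-- Min latency set cover: the special case in which every requirement equals the size of its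
hyperedge. -/
def IsMinLatency : Prop := ∀ j, I.demand j = #(I.edge j)

/-- An ordering of the vertices: `σ i` is the vertex scheduled at time `i + 1`, so that vertex `v`
is scheduled at time `σ.symm v + 1`. -/
abbrev Ordering : Type := Equiv.Perm (Fin I.n)

/-- The cover time of hyperedge `j`: the earliest time by which `demand j` of its vertices have
been scheduled. -/
def coverTime (σ : I.Ordering) (j : Fin I.m) : ℕ :=
  sInf {t : ℕ | I.demand j ≤ #{v ∈ I.edge j | (σ.symm v : ℕ) + 1 ≤ t}}

/-- The total cover time of the hyperedges. -/
def cost (σ : I.Ordering) : ℕ := ∑ j, I.coverTime σ j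

/-- The minimum total cover time over all orderings. -/
def opt : ℕ := (univ : Finset I.Ordering).inf' univ_nonempty I.cost

/-! ### The linear program with knapsack cover inequalities

Time runs through `1, 2, 3, …`; the values of `x` and `u` at time `0` are never used. -/

/-- `prefixSum f t` is the sum of `f t'` over the times `1 ≤ t' < t`. -/
def prefixSum (f : ℕ → ℝ) (t : ℕ) : ℝ := ∑ t' ∈ Ico 1 t, f t'

/-- The feasible solutions of the linear program: `x v t` is the extent to which `v` is scheduled
at time `t`, and `u j t` the extent to which hyperedge `j` is uncovered at the beginning of `t`. -/
structure LPFeasible (x : Fin I.n → ℕ → ℝ) (u : Fin I.m → ℕ → ℝ) : Prop where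
  x_nonneg : ∀ v t, 1 ≤ t → 0 ≤ x v t
  u_nonneg : ∀ j t, 1 ≤ t → 0 ≤ u j t
  capacity : ∀ t, 1 ≤ t → ∑ v, x v t ≤ 1
  knapsackCover : ∀ j t, 1 ≤ t → ∀ S ⊆ I.edge j, #S < I.demand j →
    ((I.demand j : ℝ) - #S) ≤
      ((I.demand j : ℝ) - #S) * u j t + ∑ v ∈ I.edge j \ S, prefixSum (x v) t

/-- The objective value, the sum of `u j t` over all hyperedges and all times `t ≥ 1`. -/
def lpCost (u : Fin I.m → ℕ → ℝ) : ENNReal :=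
  ∑ j, ∑' t : ℕ, ENNReal.ofReal (u j (t + 1))

/-- Optimal solutions of the linear program. -/
def LPOptimal (x : Fin I.n → ℕ → ℝ) (u : Fin I.m → ℕ → ℝ) : Prop :=
  I.LPFeasible x u ∧ ∀ x' u', I.LPFeasible x' u' → I.lpCost u ≤ I.lpCost u'

/-! ### Kernel `α`-point rounding -/

/-- The kernel `K(t, t') = α t' / (t (t + 1))` for `1 ≤ t' ≤ t`, and `0` otherwise. -/
def kernel (α : ℝ) (t t' : ℕ) : ℝ :=
  if 1 ≤ t' ∧ t' ≤ t then α * t' / (t * (t + 1)) else 0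

/-- The transformed solution `z_{v,t} = ∑_{t'} K(t, t') x_{v,t'}`, for one vertex; the terms with
`t' > t` vanish. -/
def transform (K : ℕ → ℕ → ℝ) (f : ℕ → ℝ) (t : ℕ) : ℝ := ∑ t' ∈ Icc 1 t, K t t' * f t'

/-- The earliest time `t ≥ 1` with `∑_{t' < t} z_{t'} ≥ a`; it is `⊤` if there is none. -/
def alphaPoint (z : ℕ → ℝ) (a : ℝ) : ℕ∞ := ⨅ (t : ℕ) (_ : 1 ≤ t ∧ a ≤ prefixSum z t), (t : ℕ∞)

/-- The ordering produced by the rounding algorithm from the thresholds `a v`: the vertices are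
sorted by their tentative times, and ties are broken according to `π`. -/
def rounding (K : ℕ → ℕ → ℝ) (x : Fin I.n → ℕ → ℝ) (a : Fin I.n → ℝ)
    (π : Equiv.Perm (Fin I.n)) : I.Ordering :=
  Tuple.sort fun v => toLex (alphaPoint (transform K (x v)) (a v), π v)

/-- The cost of the rounded ordering for given thresholds, averaged over a uniformly random
tie-breaking permutation. -/
def averageCost (K : ℕ → ℕ → ℝ) (x : Fin I.n → ℕ → ℝ) (a : Fin I.n → ℝ) : ℝ :=
  (∑ π : Equiv.Perm (Fin I.n), (I.cost (I.rounding K x a π) : ℝ)) / (I.n)!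

/-- The law of independent thresholds, each uniform on `[0, 1]`. -/
def thresholdLaw : Measure (Fin I.n → ℝ) :=
  Measure.pi fun _ => (volume : Measure ℝ).restrict (Set.Icc 0 1)

/-- The expected cost of the ordering produced by the rounding algorithm. -/
def expectedCost (K : ℕ → ℕ → ℝ) (x : Fin I.n → ℕ → ℝ) : ℝ :=
  ∫ a, I.averageCost K x a ∂I.thresholdLaw

end GMSSC

/-! ### A random access machine

Programs are structured programs over natural number registers and an indirectly addressed memory.
Every elementary instruction and every test costs one step. The only arithmetic is addition and
truncated subtraction, so a value grows by at most one bit per step, and polynomial time here is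
polynomial time on a Turing machine. -/

namespace RAM

/-- Contents of the registers and of the memory cells. -/
structure State where
  reg : ℕ → ℕ
  mem : ℕ → ℕ

/-- Programs. -/
inductive Program where
  /-- `r_x := k` -/
  | const (x k : ℕ)
  /-- `r_x := r_y + r_z` -/
  | add (x y z : ℕ)
  /-- `r_x := r_y - r_z` (truncated at `0`) -/
  | sub (x y z : ℕ)
  /-- `r_x := mem[r_y]` -/
  | load (x y : ℕ)
  /-- `mem[r_x] := r_y` -/
  | store (x y : ℕ)
  /-- first `p`, then `q` -/
  | seq (p q : Program)
  /-- `p` if `r_x ≠ 0`, otherwise `q` -/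
  | cond (x : ℕ) (p q : Program)
  /-- repeat `p` as long as `r_x ≠ 0` -/
  | loop (x : ℕ) (p : Program)

/-- The state after `r_x := k`. -/
def State.setReg (s : State) (x k : ℕ) : State := ⟨Function.update s.reg x k, s.mem⟩

/-- The state after `mem[a] := k`. -/
def State.setMem (s : State) (a k : ℕ) : State := ⟨s.reg, Function.update s.mem a k⟩

/-- `Exec p s T s'`: started in state `s`, the program `p` halts in state `s'` after exactly `T`
steps. -/
inductive Exec : Program → State → ℕ → State → Prop where
  | const (x k : ℕ) (s : State) : Exec (.const x k) s 1 (s.setReg x k)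
  | add (x y z : ℕ) (s : State) : Exec (.add x y z) s 1 (s.setReg x (s.reg y + s.reg z))
  | sub (x y z : ℕ) (s : State) : Exec (.sub x y z) s 1 (s.setReg x (s.reg y - s.reg z))
  | load (x y : ℕ) (s : State) : Exec (.load x y) s 1 (s.setReg x (s.mem (s.reg y)))
  | store (x y : ℕ) (s : State) : Exec (.store x y) s 1 (s.setMem (s.reg x) (s.reg y))
  | seq {p q : Program} {s s' s'' : State} {T T' : ℕ} :
      Exec p s T s' → Exec q s' T' s'' → Exec (.seq p q) s (T + T') s''
  | cond_pos {x : ℕ} {p q : Program} {s s' : State} {T : ℕ} :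
      s.reg x ≠ 0 → Exec p s T s' → Exec (.cond x p q) s (T + 1) s'
  | cond_zero {x : ℕ} {p q : Program} {s s' : State} {T : ℕ} :
      s.reg x = 0 → Exec q s T s' → Exec (.cond x p q) s (T + 1) s'
  | loop_pos {x : ℕ} {p : Program} {s s' s'' : State} {T T' : ℕ} :
      s.reg x ≠ 0 → Exec p s T s' → Exec (.loop x p) s' T' s'' →
      Exec (.loop x p) s (T + T' + 1) s''
  | loop_zero {x : ℕ} {p : Program} {s : State} :
      s.reg x = 0 → Exec (.loop x p) s 1 s

open Classical in
/-- The initial state for a min latency set cover instance: cell `0` holds the number `n` of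
vertices, cell `1` the number of hyperedges, and cell `2 + j * n + v` holds `1` if vertex `v` lies
in hyperedge `j`; everything else is `0`. -/
def input (I : GMSSC) : State where
  reg := fun _ => 0
  mem := fun c =>
    if c = 0 then I.n
    else if c = 1 then I.m
    else if ∃ j : Fin I.m, ∃ v ∈ I.edge j, c = 2 + j * I.n + v then 1 else 0

/-- The ordering `σ` is written in the first `n` memory cells: cell `i` holds the vertex that is
scheduled at time `i + 1`. -/
def Outputs {I : GMSSC} (s : State) (σ : I.Ordering) : Prop := ∀ i : Fin I.n, s.mem i = σ i

/-- `p` is a (deterministic, polynomial time) `ρ`-approximation algorithm for min latency set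
cover: on every instance it halts after a number of steps that is polynomial in the numbers of
vertices and hyperedges, and outputs an ordering whose cost is at most `ρ` times the optimum. -/
def IsMinLatencyApprox (p : Program) (ρ : ℝ) : Prop :=
  ∃ C d : ℕ, ∀ I : GMSSC, I.IsMinLatency →
    ∃ (T : ℕ) (s : State) (σ : I.Ordering),
      Exec p (input I) T s ∧ T ≤ C * (I.n + I.m + 1) ^ d ∧
      Outputs s σ ∧ (I.cost σ : ℝ) ≤ ρ * I.opt

end RAM

end

/-! Part (i) is proved by a combinatorial algorithm that needs no linear program. Every hyperedge
distributes `Q = n²` tokens over its vertices; the load `ℓ(v)` is the number of tokens on `v`. If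
each token is charged the cover time of its hyperedge, then `Q` times the cost of any ordering is at
least `∑ ℓ(v) · pos(v)`. Comparing the two vertices of each pair shows that twice this sum is at
least `∑_{v,w} min(ℓ(v), ℓ(w)) + mQ` (`sum_min_load_le`).

Conversely, suppose that no token can move within its hyperedge to a vertex whose load is smaller by
at least 2. If `e` has a token on `v`, all vertices of `e` then have load at least `ℓ(v) - 1`, so
the order of decreasing loads covers `e` by time `#{w | ℓ(w) ≥ ℓ(v) - 1}`. Symmetrizing bounds `Q`
times its cost by `∑ min(ℓ(v), ℓ(w)) + n²/2`. The error term is absorbed by `mQ`, which gives the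
factor 2 (`cost_le_two_mul_opt`). Local search finds such a distribution in polynomial time, because
each move lowers `∑ ℓ(v)²`, which is at most `(mQ)²`. The rest of this half implements initial
distribution, local search and sorting on the register machine.

For part (ii), the kernel is chosen so that the prefix sum of `z_v` up to `t` is `α` times the
average of the first `t` prefix sums of `x_v` (`mul_prefixSum_transform`), while each time carries
total mass at most `α/2` (`sum_transform_le`). The knapsack cover inequality for `S = e \ {v}` says
that each `v ∈ e` has prefix sum at least `1 - u_{e,t}`. Averaging up to `D = ⌈α/(α-1) · ∑_t
u_{e,t}⌉` therefore gives every vertex of `e` transformed mass at least 1, so all of them reach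
their thresholds by time `D`, whatever the thresholds are. The cover time of `e` is then at most the
number of vertices with tentative time at most `D`, whose expectation is at most `α/2 · (D - 1) ≤
α²/(2(α-1)) · ∑_t u_{e,t}`. Summing over `e` compares the expected cost with the LP value, which is
at most OPT. -/

noncomputable section

set_option linter.unusedSimpArgs false

/-! ### Program logic for the register machine -/

namespace RAM

namespace Program

/-- A sequence of programs, executed one after the other. -/
def block : List Program → Program
  | [] => const 0 0
  | [p] => p
  | p :: q :: l => seq p (block (q :: l))

/-- Programs without loops. -/
def LoopFree : Program → Prop
  | seq p q => p.LoopFree ∧ q.LoopFree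
  | cond _ p q => p.LoopFree ∧ q.LoopFree
  | loop _ _ => False
  | _ => True

/-- An upper bound on the number of steps of a loop-free program. -/
def length : Program → ℕ
  | seq p q => p.length + q.length
  | cond _ p q => p.length + q.length + 1
  | _ => 1

/-- The effect of a loop-free program. -/
def eval : Program → State → State
  | const x k, s => s.setReg x k
  | add x y z, s => s.setReg x (s.reg y + s.reg z)
  | sub x y z, s => s.setReg x (s.reg y - s.reg z)
  | load x y, s => s.setReg x (s.mem (s.reg y))
  | store x y, s => s.setMem (s.reg x) (s.reg y)
  | seq p q, s => q.eval (p.eval s)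
  | cond x p q, s => if s.reg x = 0 then q.eval s else p.eval s
  | loop _ _, s => s

end Program

@[simp] theorem State.setReg_reg (s : State) (x k y : ℕ) :
    (s.setReg x k).reg y = if y = x then k else s.reg y := by
  simp [State.setReg, Function.update_apply]

@[simp] theorem State.setReg_mem (s : State) (x k : ℕ) : (s.setReg x k).mem = s.mem := rfl

@[simp] theorem State.setMem_reg (s : State) (x k : ℕ) : (s.setMem x k).reg = s.reg := rfl

/-- `Halts p s B P`: started in state `s`, the program `p` halts after at most `B` steps in a state
that satisfies `P`. -/
def Halts (p : Program) (s : State) (B : ℕ) (P : State → Prop) : Prop :=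
  ∃ T s', Exec p s T s' ∧ T ≤ B ∧ P s'

theorem Halts.mono {p : Program} {s : State} {B B' : ℕ} {P P' : State → Prop}
    (h : Halts p s B P) (hB : B ≤ B') (hP : ∀ s', P s' → P' s') : Halts p s B' P' := by
  obtain ⟨T, s', he, hT, hs⟩ := h
  exact ⟨T, s', he, hT.trans hB, hP _ hs⟩

theorem Halts.seq {p q : Program} {s : State} {B B' : ℕ} {P P' : State → Prop}
    (h : Halts p s B P) (h' : ∀ s', P s' → Halts q s' B' P') :
    Halts (.seq p q) s (B + B') P' := by
  obtain ⟨T, s', he, hT, hs⟩ := h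
  obtain ⟨T', s'', he', hT', hs'⟩ := h' s' hs
  exact ⟨T + T', s'', he.seq he', by omega, hs'⟩

theorem Halts.of_loopFree {p : Program} (hp : p.LoopFree) (s : State) {P : State → Prop}
    (h : P (p.eval s)) : Halts p s p.length P := by
  suffices H : ∃ T, Exec p s T (p.eval s) ∧ T ≤ p.length by
    obtain ⟨T, he, hT⟩ := H
    exact ⟨T, _, he, hT, h⟩
  clear h
  induction p generalizing s with
  | const x k => exact ⟨1, .const x k s, le_rfl⟩
  | add x y z => exact ⟨1, .add x y z s, le_rfl⟩
  | sub x y z => exact ⟨1, .sub x y z s, le_rfl⟩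
  | load x y => exact ⟨1, .load x y s, le_rfl⟩
  | store x y => exact ⟨1, .store x y s, le_rfl⟩
  | seq p q ihp ihq =>
    obtain ⟨T, he, hT⟩ := ihp hp.1 s
    obtain ⟨T', he', hT'⟩ := ihq hp.2 (p.eval s)
    exact ⟨T + T', he.seq he', by simp only [Program.length]; omega⟩
  | cond x p q ihp ihq =>
    by_cases hx : s.reg x = 0
    · obtain ⟨T, he, hT⟩ := ihq hp.2 s
      exact ⟨T + 1, by simpa [Program.eval, hx] using Exec.cond_zero hx he,
        by simp only [Program.length]; omega⟩
    · obtain ⟨T, he, hT⟩ := ihp hp.1 s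
      exact ⟨T + 1, by simpa [Program.eval, hx] using Exec.cond_pos hx he,
        by simp only [Program.length]; omega⟩
  | loop x p => exact hp.elim

/-- A loop with a loop-free body halts if a measure decreases in every round. -/
theorem Halts.loop {x : ℕ} {p : Program} (hp : p.LoopFree) (Inv : ℕ → State → Prop)
    (step : ∀ k s, Inv k s → s.reg x ≠ 0 → ∃ k' < k, Inv k' (p.eval s)) (k : ℕ) (s : State)
    (h : Inv k s) :
    Halts (.loop x p) s ((p.length + 1) * k + 1) fun s' => s'.reg x = 0 ∧ ∃ k', Inv k' s' := by
  induction k using Nat.strong_induction_on generalizing s with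
  | _ k ih =>
    by_cases hx : s.reg x = 0
    · exact ⟨1, s, .loop_zero hx, by omega, hx, k, h⟩
    · obtain ⟨k', hk, hI⟩ := step k s h hx
      obtain ⟨T', s', he', hT', hs'⟩ := ih k' hk _ hI
      obtain ⟨T, s'', he, hT, rfl⟩ := Halts.of_loopFree hp s (P := fun t => t = p.eval s) rfl
      refine ⟨T + T' + 1, s', .loop_pos hx he he', ?_, hs'⟩
      have : (p.length + 1) * (k' + 1) ≤ (p.length + 1) * k := Nat.mul_le_mul_left _ hk
      nlinarith

end RAM

/-! ### Cover times, token assignments and the factor 2 -/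

namespace GMSSC

variable {I : GMSSC}

theorem coverTime_le_iff (hI : I.IsMinLatency) (σ : I.Ordering) (j : Fin I.m) (t : ℕ) :
    I.coverTime σ j ≤ t ↔ ∀ v ∈ I.edge j, (σ.symm v : ℕ) + 1 ≤ t := by
  have key : ∀ t, I.demand j ≤ #{v ∈ I.edge j | (σ.symm v : ℕ) + 1 ≤ t} ↔
      ∀ v ∈ I.edge j, (σ.symm v : ℕ) + 1 ≤ t := by
    intro t
    rw [hI j, ← Finset.filter_eq_self]
    exact ⟨fun h => Finset.eq_of_subset_of_card_le (Finset.filter_subset _ _) h,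
      fun h => by rw [h]⟩
  unfold coverTime
  simp only [key]
  constructor
  · intro h v hv
    -- The infimum of the empty set would be 0; time `n` always belongs to the set.
    have hne : {t : ℕ | ∀ v ∈ I.edge j, (σ.symm v : ℕ) + 1 ≤ t}.Nonempty :=
      ⟨I.n, fun v _ => (σ.symm v).isLt⟩
    exact (Nat.sInf_mem hne v hv).trans h
  · intro h
    exact Nat.sInf_le h

theorem coverTime_le (hI : I.IsMinLatency) (σ : I.Ordering) (j : Fin I.m) :
    I.coverTime σ j ≤ I.n :=
  (coverTime_le_iff hI σ j _).2 fun v _ => (σ.symm v).isLt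

theorem succ_le_coverTime (hI : I.IsMinLatency) (σ : I.Ordering) {j : Fin I.m} {v : Fin I.n}
    (hv : v ∈ I.edge j) : (σ.symm v : ℕ) + 1 ≤ I.coverTime σ j :=
  (coverTime_le_iff hI σ j _).1 le_rfl v hv

theorem exists_cost_eq_opt (I : GMSSC) : ∃ σ, I.cost σ = I.opt := by
  obtain ⟨σ, -, h⟩ := Finset.exists_mem_eq_inf' (univ_nonempty (α := I.Ordering)) I.cost
  exact ⟨σ, h.symm⟩

/-! ### Token assignments -/

/-- Every hyperedge distributes `Q` tokens over its vertices. -/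
structure IsAssignment (I : GMSSC) (Q : ℕ) (y : Fin I.m → Fin I.n → ℕ) : Prop where
  mem_edge : ∀ e v, y e v ≠ 0 → v ∈ I.edge e
  sum_eq : ∀ e, ∑ v, y e v = Q

/-- The number of tokens on a vertex. -/
def load (I : GMSSC) (y : Fin I.m → Fin I.n → ℕ) (v : Fin I.n) : ℕ := ∑ e, y e v

/-- Moving a token of `e` from `v` to `w` makes the loads more even. -/
def Improvable (I : GMSSC) (y : Fin I.m → Fin I.n → ℕ) (e : Fin I.m) (v w : Fin I.n) : Prop :=
  y e v ≠ 0 ∧ w ∈ I.edge e ∧ I.load y w + 2 ≤ I.load y v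

/-- The assignment after a token of `e` has been moved from `v` to `w`. -/
def moveToken (y : Fin I.m → Fin I.n → ℕ) (e : Fin I.m) (v w : Fin I.n) :
    Fin I.m → Fin I.n → ℕ := fun e' v' =>
  if e' = e ∧ v' = v then y e v - 1 else if e' = e ∧ v' = w then y e w + 1 else y e' v'

variable {Q : ℕ} {y : Fin I.m → Fin I.n → ℕ} {e : Fin I.m} {v w : Fin I.n}

theorem Improvable.ne (h : I.Improvable y e v w) : v ≠ w := by
  rintro rfl
  have := h.2.2
  omega

theorem sum_load (hy : I.IsAssignment Q y) : ∑ v, I.load y v = I.m * Q := by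
  simp only [load]
  rw [Finset.sum_comm]
  simp [hy.sum_eq]

theorem load_moveToken (h : I.Improvable y e v w) (v' : Fin I.n) :
    I.load (moveToken y e v w) v' =
      if v' = v then I.load y v - 1 else if v' = w then I.load y w + 1 else I.load y v' := by
  have hne := h.ne
  have hy := h.1
  have split : ∀ f : Fin I.m → ℕ, ∑ e', f e' = f e + ∑ e' ∈ univ.erase e, f e' := fun f =>
    (Finset.add_sum_erase _ f (mem_univ e)).symm
  have rest : ∑ e' ∈ univ.erase e, moveToken y e v w e' v' = ∑ e' ∈ univ.erase e, y e' v' := by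
    refine Finset.sum_congr rfl fun e' he => ?_
    simp [moveToken, Finset.ne_of_mem_erase he]
  unfold load
  rw [split, rest]
  split_ifs with h1 h2
  · subst h1
    rw [split (fun e' => y e' v')]
    simp only [moveToken]
    simp
    omega
  · subst h2
    rw [split (fun e' => y e' v')]
    simp [moveToken, h1]
    omega
  · rw [split (fun e' => y e' v')]
    simp [moveToken, h1, h2]

/-- Exposing a common remainder `R` lets sums before and after a token move be compared in `ℕ`
without subtraction. -/
theorem sum_update_pair {ι : Type*} [Fintype ι] [DecidableEq ι] {v w : ι} (hne : v ≠ w)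
    (f g : ι → ℕ) (h : ∀ i, i ≠ v → i ≠ w → f i = g i) :
    ∃ R, ∑ i, f i = f v + f w + R ∧ ∑ i, g i = g v + g w + R := by
  have split : ∀ f : ι → ℕ, ∑ i, f i = f v + f w + ∑ i ∈ (univ.erase v).erase w, f i := by
    intro f
    rw [add_assoc, Finset.add_sum_erase _ f (by simp [hne.symm]),
      Finset.add_sum_erase _ f (mem_univ v)]
  refine ⟨_, split f, ?_⟩
  rw [split g]
  congr 1
  refine Finset.sum_congr rfl fun i hi => ?_
  simp only [mem_erase, mem_univ, and_true] at hi
  exact (h i hi.2 hi.1).symm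

theorem IsAssignment.moveToken (hy : I.IsAssignment Q y) (h : I.Improvable y e v w) :
    I.IsAssignment Q (moveToken y e v w) := by
  have hne := h.ne
  refine ⟨fun e' v' h' => ?_, fun e' => ?_⟩
  · unfold GMSSC.moveToken at h'
    split_ifs at h' with h1 h2
    · rw [h1.1, h1.2]; exact hy.mem_edge _ _ h.1
    · rw [h2.1, h2.2]; exact h.2.1
    · exact hy.mem_edge _ _ h'
  · rw [← hy.sum_eq e']
    by_cases he : e' = e
    · subst he
      obtain ⟨R, h1, h2⟩ := sum_update_pair hne (GMSSC.moveToken y e' v w e') (y e')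
        (fun i hv hw => by simp [GMSSC.moveToken, hv, hw])
      have hv : GMSSC.moveToken y e' v w e' v = y e' v - 1 := by simp [GMSSC.moveToken]
      have hw : GMSSC.moveToken y e' v w e' w = y e' w + 1 := by
        simp [GMSSC.moveToken, hne.symm]
      have := h.1
      omega
    · simp [GMSSC.moveToken, he]

/-- If `a ≥ b + 2`, replacing `a, b` by `a - 1, b + 1` lowers the sum of squares by `2(a - b - 1)`.
This potential bounds the number of moves of the local search. -/
theorem sum_sq_load_moveToken_lt (h : I.Improvable y e v w) :
    ∑ v', I.load (moveToken y e v w) v' ^ 2 < ∑ v', I.load y v' ^ 2 := by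
  have hne := h.ne
  obtain ⟨R, h1, h2⟩ := sum_update_pair hne (fun v' => I.load (moveToken y e v w) v' ^ 2)
    (fun v' => I.load y v' ^ 2) (fun i hv hw => by simp [load_moveToken h, hv, hw])
  rw [h1, h2]
  simp only [load_moveToken h, if_true, hne.symm, if_false]
  have := h.2.2
  obtain ⟨k, hk⟩ := Nat.exists_eq_add_of_le this
  rw [hk]
  have : I.load y w + 2 + k - 1 = I.load y w + 1 + k := by omega
  rw [this]
  nlinarith

theorem sum_sq_load_le (hy : I.IsAssignment Q y) :
    ∑ v, I.load y v ^ 2 ≤ (I.m * Q) ^ 2 := by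
  rw [← sum_load hy]
  exact Finset.sum_sq_le_sq_sum_of_nonneg (fun _ _ => Nat.zero_le _)

theorem mul_cost_eq (hy : I.IsAssignment Q y) (σ : I.Ordering) :
    Q * I.cost σ = ∑ e, ∑ v, y e v * I.coverTime σ e := by
  simp only [cost, Finset.mul_sum, ← Finset.sum_mul, hy.sum_eq]

theorem card_symm_le (σ : I.Ordering) (v : Fin I.n) :
    #{w | σ.symm w ≤ σ.symm v} = (σ.symm v : ℕ) + 1 := by
  rw [← Fin.card_Iic]
  refine Finset.card_bij (fun w _ => σ.symm w) (by simp) (by simp) fun b hb => ⟨σ b, by simpa using hb, by simp⟩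

/-- Every ordering pays for every token at least the position of its vertex. -/
theorem sum_min_load_le (hI : I.IsMinLatency) (hy : I.IsAssignment Q y) (σ : I.Ordering) :
    ∑ v, ∑ w, min (I.load y v) (I.load y w) + I.m * Q ≤ 2 * (Q * I.cost σ) := by
  -- A vertex carrying a token of `e` lies in `e`, so its position is at most the cover time of `e`.
  have h1 : ∑ v, I.load y v * #{w | σ.symm w ≤ σ.symm v} ≤ Q * I.cost σ := by
    rw [mul_cost_eq hy, Finset.sum_comm]
    refine Finset.sum_le_sum fun v _ => ?_
    rw [load, Finset.sum_mul]
    refine Finset.sum_le_sum fun e _ => ?_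
    by_cases h0 : y e v = 0
    · simp [h0]
    · rw [card_symm_le]
      exact Nat.mul_le_mul_left _ (succ_le_coverTime hI σ (hy.mem_edge e v h0))
  have h2 : ∑ v, I.load y v * #{w | σ.symm w ≤ σ.symm v} =
      ∑ v, ∑ w, if σ.symm w ≤ σ.symm v then I.load y v else 0 := by
    refine Finset.sum_congr rfl fun v _ => ?_
    rw [← Finset.sum_filter, Finset.sum_const, smul_eq_mul, mul_comm]
  have h3 : ∑ v, ∑ w, (if σ.symm w ≤ σ.symm v then I.load y v else 0) =
      ∑ v, ∑ w, if σ.symm v ≤ σ.symm w then I.load y w else 0 := Finset.sum_comm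
  -- The diagonal occurs in both orientations of the double sum but only once in the sum of minima;
  -- the surplus is the total load.
  have h4 : I.m * Q = ∑ v, ∑ w, if v = w then I.load y v else 0 := by
    simp [sum_load hy]
  have h5 : ∑ v, ∑ w, min (I.load y v) (I.load y w) + I.m * Q ≤
      ∑ v, ∑ w, (if σ.symm w ≤ σ.symm v then I.load y v else 0) +
      ∑ v, ∑ w, if σ.symm v ≤ σ.symm w then I.load y w else 0 := by
    rw [h4]
    simp only [← Finset.sum_add_distrib]
    refine Finset.sum_le_sum fun v _ => Finset.sum_le_sum fun w _ => ?_
    by_cases hvw : v = w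
    · subst hvw; simp
    · rcases le_total (σ.symm v) (σ.symm w) with h | h <;> simp [h, hvw]
  omega

/-- Ordering the vertices by decreasing loads is a `2`-approximation if no token can be moved to
make the loads more even. -/
theorem cost_le_two_mul_opt (hI : I.IsMinLatency) (hy : I.IsAssignment (I.n * I.n) y)
    (hbal : ∀ e v w, ¬ I.Improvable y e v w) (σ : I.Ordering)
    (hσ : ∀ v w, I.load y v < I.load y w → σ.symm w < σ.symm v) :
    I.cost σ ≤ 2 * I.opt := by
  obtain ⟨τ, hτ⟩ := exists_cost_eq_opt I
  rw [← hτ]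
  rcases Nat.eq_zero_or_pos I.m with hm | hm
  · have : IsEmpty (Fin I.m) := by rw [hm]; infer_instance
    simp [cost]
  have hn : 0 < I.n := by
    have h1 := I.demand_pos ⟨0, hm⟩
    have h2 := I.demand_le ⟨0, hm⟩
    obtain ⟨v, -⟩ := Finset.card_pos.1 (h1.trans h2)
    exact v.pos
  have h1 : (I.n * I.n) * I.cost σ ≤
      ∑ v, ∑ w, if I.load y v ≤ I.load y w + 1 then I.load y v else 0 := by
    rw [mul_cost_eq hy, Finset.sum_comm]
    refine Finset.sum_le_sum fun v _ => ?_
    rw [← Finset.sum_filter, Finset.sum_const, smul_eq_mul, mul_comm, load, Finset.sum_mul]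
    refine Finset.sum_le_sum fun e _ => ?_
    by_cases h0 : y e v = 0
    · simp [h0]
    refine Nat.mul_le_mul_left _ ((coverTime_le_iff hI σ e _).2 fun w hw => ?_)
    rw [← card_symm_le]
    refine Finset.card_le_card fun w' hw' => ?_
    simp only [mem_filter, mem_univ, true_and] at hw' ⊢
    -- Balance gives `load v ≤ load w + 1`. A vertex `w'` violating this bound would have a smaller
    -- load than `w`, hence come after `w`.
    have hb := hbal e v w
    simp only [Improvable, h0, hw, not_and, ne_eq, not_false_iff, true_implies] at hb
    by_contra hlt
    have := hσ w' w (by simp only [load] at *; omega)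
    exact absurd hw' (not_le.2 this)
  have h2 : ∑ v, ∑ w, (if I.load y v ≤ I.load y w + 1 then I.load y v else 0) =
      ∑ v, ∑ w, if I.load y w ≤ I.load y v + 1 then I.load y w else 0 := Finset.sum_comm
  -- Both terms of a pair survive only if the loads differ by at most 1, so a pair exceeds twice its
  -- minimum by at most 1.
  have h3 : ∑ v, ∑ w, (if I.load y v ≤ I.load y w + 1 then I.load y v else 0) +
      ∑ v, ∑ w, (if I.load y w ≤ I.load y v + 1 then I.load y w else 0) ≤
      2 * (∑ v, ∑ w, min (I.load y v) (I.load y w)) + I.n * I.n := by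
    have : I.n * I.n = ∑ v : Fin I.n, ∑ w : Fin I.n, 1 := by simp
    rw [this]
    simp only [Finset.mul_sum, ← Finset.sum_add_distrib]
    refine Finset.sum_le_sum fun v _ => Finset.sum_le_sum fun w _ => ?_
    rcases le_total (I.load y v) (I.load y w) with h | h
    · rw [min_eq_left h]; split_ifs <;> omega
    · rw [min_eq_right h]; split_ifs <;> omega
  have h4 := sum_min_load_le hI hy τ
  -- The reason for `n²` tokens per hyperedge: the rounding loss over all pairs is covered by the
  -- total load.
  have h5 : I.n * I.n ≤ I.m * (I.n * I.n) := Nat.le_mul_of_pos_left _ hm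
  have h6 : (I.n * I.n) * I.cost σ ≤ (I.n * I.n) * (2 * I.cost τ) := by
    have : (I.n * I.n) * (2 * I.cost τ) = 2 * (I.n * I.n * I.cost τ) := by ring
    omega
  exact Nat.le_of_mul_le_mul_left h6 (Nat.mul_pos hn hn)

end GMSSC

namespace GMSSC

variable {I : GMSSC}

/-! ### Addresses -/

theorem cell_lt {n m e v : ℕ} (he : e < m) (hv : v < n) : e * n + v < m * n := by
  have : (e + 1) * n ≤ m * n := Nat.mul_le_mul_right _ he
  rw [add_mul] at this
  omega

theorem cell_inj {n e v e' v' : ℕ} (hv : v < n) (hv' : v' < n) :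
    e * n + v = e' * n + v' ↔ e = e' ∧ v = v' := by
  refine ⟨fun h => ?_, by rintro ⟨rfl, rfl⟩; rfl⟩
  have hn : 0 < n := by omega
  have h1 : (e * n + v) / n = e := by
    rw [mul_comm, Nat.mul_add_div hn, Nat.div_eq_of_lt hv, add_zero]
  have h2 : (e' * n + v') / n = e' := by
    rw [mul_comm, Nat.mul_add_div hn, Nat.div_eq_of_lt hv', add_zero]
  have h3 : e = e' := by rw [← h1, h, h2]
  subst h3
  exact ⟨rfl, by omega⟩

theorem n_pos_of_edge (j : Fin I.m) : 0 < I.n := by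
  obtain ⟨v, -⟩ := Finset.card_pos.1 ((I.demand_pos j).trans (I.demand_le j))
  exact v.pos

theorem edge_nonempty (j : Fin I.m) : (I.edge j).Nonempty :=
  Finset.card_pos.1 ((I.demand_pos j).trans (I.demand_le j))

/-! ### The order of decreasing loads -/

/-- `w` has to be scheduled before `v` when the vertices are sorted by decreasing `l`. -/
def Before (l : Fin I.n → ℕ) (w v : Fin I.n) : Prop := l v < l w ∨ l v = l w ∧ w < v

instance (l : Fin I.n → ℕ) (w v : Fin I.n) : Decidable (Before l w v) := by
  unfold Before; infer_instance

/-- The number of vertices that are scheduled before `v`. -/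
def rank (l : Fin I.n → ℕ) (v : Fin I.n) : ℕ := #{w | Before l w v}

theorem rank_lt_rank {l : Fin I.n → ℕ} {w v : Fin I.n} (h : Before l w v) :
    rank l w < rank l v := by
  refine Finset.card_lt_card ⟨fun x hx => ?_, fun hsub => ?_⟩
  · have hx' := (mem_filter.1 hx).2
    refine mem_filter.2 ⟨mem_univ _, ?_⟩
    simp only [Before] at *
    omega
  · have := (mem_filter.1 (hsub (mem_filter.2 ⟨mem_univ w, h⟩))).2
    simp [Before] at this

theorem rank_lt (l : Fin I.n → ℕ) (v : Fin I.n) : rank l v < I.n := by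
  have : rank l v < #(univ : Finset (Fin I.n)) :=
    Finset.card_lt_card ⟨Finset.filter_subset _ _, fun h => by
      have := (mem_filter.1 (h (mem_univ v))).2
      simp [Before] at this⟩
  simpa using this

theorem rank_injective (l : Fin I.n → ℕ) : Function.Injective (rank l) := by
  intro v w h
  by_contra hne
  have : Before l v w ∨ Before l w v := by
    simp only [Before]
    have := Fin.val_ne_of_ne hne
    omega
  rcases this with h' | h' <;> have := rank_lt_rank h' <;> omega

theorem exists_ordering_symm_eq_rank (l : Fin I.n → ℕ) :
    ∃ σ : I.Ordering, ∀ v, (σ.symm v : ℕ) = rank l v := by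
  let f : Fin I.n → Fin I.n := fun v => ⟨rank l v, rank_lt l v⟩
  have hf : Function.Bijective f := Finite.injective_iff_bijective.1 fun v w h =>
    rank_injective l (congrArg Fin.val h)
  exact ⟨(Equiv.ofBijective f hf).symm, fun v => rfl⟩

/-! ### The memory during the local search -/

/-- The address of the first load. -/
def loadBase (I : GMSSC) : ℕ := 2 + I.m * I.n + I.n

/-- The offset between an incidence and the corresponding number of tokens. -/
def tokenBase (I : GMSSC) : ℕ := I.loadBase + I.n

/-- The memory contains the incidences, the numbers of tokens `y` and the loads `l`. -/
structure Holds (I : GMSSC) (y : Fin I.m → Fin I.n → ℕ) (l : Fin I.n → ℕ) (mem : ℕ → ℕ) :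
    Prop where
  inc : ∀ (e : Fin I.m) (v : Fin I.n), mem (2 + e * I.n + v) = if v ∈ I.edge e then 1 else 0
  tok : ∀ (e : Fin I.m) (v : Fin I.n), mem (I.tokenBase + (2 + e * I.n + v)) = y e v
  ld : ∀ v : Fin I.n, mem (I.loadBase + v) = l v

variable {y : Fin I.m → Fin I.n → ℕ} {l : Fin I.n → ℕ} {mem : ℕ → ℕ}

theorem Holds.update_tok (h : I.Holds y l mem) (e : Fin I.m) (v : Fin I.n) (k : ℕ) :
    I.Holds (fun e' v' => if e' = e ∧ v' = v then k else y e' v') l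
      (Function.update mem (I.tokenBase + (2 + e * I.n + v)) k) := by
  refine ⟨fun e' v' => ?_, fun e' v' => ?_, fun v' => ?_⟩
  · rw [Function.update_of_ne, h.inc]
    have := cell_lt e'.isLt v'.isLt
    simp only [tokenBase, loadBase]
    omega
  · by_cases hev : e' = e ∧ v' = v
    · obtain ⟨rfl, rfl⟩ := hev
      simp
    · rw [Function.update_of_ne, h.tok, if_neg hev]
      intro heq
      have := (cell_inj (e := e') (e' := e) v'.isLt v.isLt).1 (by omega)
      exact hev ⟨Fin.ext this.1, Fin.ext this.2⟩
  · rw [Function.update_of_ne, h.ld]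
    simp only [tokenBase, loadBase]
    omega

theorem Holds.update_ld (h : I.Holds y l mem) (v : Fin I.n) (k : ℕ) :
    I.Holds y (Function.update l v k) (Function.update mem (I.loadBase + v) k) := by
  refine ⟨fun e' v' => ?_, fun e' v' => ?_, fun v' => ?_⟩
  · rw [Function.update_of_ne, h.inc]
    have := cell_lt e'.isLt v'.isLt
    simp only [loadBase]
    omega
  · rw [Function.update_of_ne, h.tok]
    simp only [tokenBase]
    omega
  · by_cases hv : v' = v
    · subst hv; simp
    · rw [Function.update_of_ne, h.ld, Function.update_of_ne hv]
      have := Fin.val_ne_of_ne hv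
      omega

/-- All four new values come from the old memory, so `v ≠ w` ensures that the successive writes have
the effect of a single move. -/
theorem Holds.moveToken {e : Fin I.m} {v w : Fin I.n} (h : I.Holds y (I.load y) mem)
    (hi : I.Improvable y e v w) :
    I.Holds (moveToken y e v w) (I.load (GMSSC.moveToken y e v w))
      (Function.update (Function.update (Function.update (Function.update mem
        (I.tokenBase + (2 + e * I.n + v)) (y e v - 1))
        (I.tokenBase + (2 + e * I.n + w)) (y e w + 1))
        (I.loadBase + v) (I.load y v - 1))
        (I.loadBase + w) (I.load y w + 1)) := by
  have hne := hi.ne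
  have := (((h.update_tok e v (y e v - 1)).update_tok e w (y e w + 1)).update_ld v
    (I.load y v - 1)).update_ld w (I.load y w + 1)
  convert this using 1
  · ext e' v'
    unfold GMSSC.moveToken
    by_cases h1 : v' = v
    · subst h1; simp [hne]
    · simp [h1]
  · ext v'
    rw [load_moveToken hi]
    by_cases h1 : v' = v
    · subst h1; simp [hne]
    · by_cases h2 : v' = w
      · subst h2; simp [h1]
      · simp [h1, h2]

/-- A hyperedge without tokens puts `Q` tokens on a vertex. -/
def placeTokens (Q : ℕ) (y : Fin I.m → Fin I.n → ℕ) (e : Fin I.m) (v : Fin I.n) :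
    Fin I.m → Fin I.n → ℕ :=
  fun e' v' => if e' = e ∧ v' = v then Q else y e' v'

theorem load_placeTokens {Q : ℕ} {e : Fin I.m} (he : ∀ v, y e v = 0) (v v' : Fin I.n) :
    I.load (placeTokens Q y e v) v' = Function.update (I.load y) v (I.load y v + Q) v' := by
  have split : ∀ f : Fin I.m → ℕ, ∑ e', f e' = f e + ∑ e' ∈ univ.erase e, f e' := fun f =>
    (Finset.add_sum_erase _ f (mem_univ e)).symm
  have rest : ∑ e' ∈ univ.erase e, placeTokens Q y e v e' v' = ∑ e' ∈ univ.erase e, y e' v' := by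
    refine Finset.sum_congr rfl fun e' he => ?_
    simp [placeTokens, Finset.ne_of_mem_erase he]
  have h1 := split (fun e' => y e' v')
  have h2 := split (fun e' => placeTokens Q y e v e' v')
  rw [rest] at h2
  by_cases hv : v' = v
  · subst hv
    simp only [Function.update_self, load]
    rw [h1, h2]
    simp [placeTokens, he, add_comm]
  · rw [Function.update_of_ne hv]
    simp only [load]
    rw [h1, h2]
    simp [placeTokens, he, hv]

end GMSSC

/-! ### Setting up the registers -/

namespace RAM

theorem State.setMem_mem_eq_update (s : State) (x k : ℕ) :
    (s.setMem x k).mem = Function.update s.mem x k := rfl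

open Program

/-- The registers that are fixed after the setup. -/
structure Params (I : GMSSC) (s : State) : Prop where
  n : s.reg 0 = I.n
  m : s.reg 1 = I.m
  one : s.reg 2 = 1
  tokens : s.reg 3 = I.n * I.n
  incEnd : s.reg 4 = 2 + I.m * I.n
  loads : s.reg 5 = I.loadBase
  offset : s.reg 6 = I.tokenBase

/-- Adds register `7` times register `0` to register `x`; register `7` becomes `0`. -/
def countdown (x : ℕ) : Program := loop 7 (block [add x x 0, sub 7 7 2])

/-- Computes the parameters. -/
def setup : Program :=
  block [block [const 2 1, load 0 30, load 1 2, add 7 0 30], countdown 3,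
    block [const 4 2, add 7 1 30], countdown 4,
    block [add 5 4 0, add 6 5 0, const 8 2, const 9 0, const 11 0, sub 7 4 8]]

/-- Products such as `m * n` are formed by repeated addition, there being no multiplication
instruction. The target must avoid the summand (register 0), the constant 1 (register 2) and the
counter (register 7). -/
theorem countdown_halts (x : ℕ) (hx0 : x ≠ 0) (hx2 : x ≠ 2) (hx7 : x ≠ 7) (s : State)
    (h2 : s.reg 2 = 1) :
    Halts (countdown x) s (3 * s.reg 7 + 1) fun s' => s'.mem = s.mem ∧
      s'.reg x = s.reg x + s.reg 7 * s.reg 0 ∧ ∀ i, i ≠ x → i ≠ 7 → s'.reg i = s.reg i := by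
  refine (Halts.loop (p := block [add x x 0, sub 7 7 2]) ?_ (fun k s' => s'.reg 7 = k ∧
    s'.mem = s.mem ∧ s'.reg x + k * s.reg 0 = s.reg x + s.reg 7 * s.reg 0 ∧
    ∀ i, i ≠ x → i ≠ 7 → s'.reg i = s.reg i) ?_ (s.reg 7) s ?_).mono ?_ ?_
  · simp [block, LoopFree]
  · rintro k s' ⟨h7, hm, hx, hi⟩ hne
    rw [h7] at hne
    refine ⟨k - 1, by omega, ?_⟩
    have h2' := hi 2 hx2.symm (by decide)
    have h0' := hi 0 hx0.symm (by decide)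
    obtain ⟨k, rfl⟩ := Nat.exists_eq_succ_of_ne_zero hne
    refine ⟨?_, ?_, ?_, ?_⟩
    · simp [block, eval, hx7.symm, h7, h2', h2, hx2.symm]
    · simp [block, eval, hm]
    · simp only [block, eval, State.setReg_reg, hx7, if_true, if_false, h0']
      simp only [Nat.succ_eq_add_one, Nat.add_sub_cancel, ← hx]
      ring
    · intro i h1 h2
      simp [block, eval, h1, h2, hi]
  · exact ⟨rfl, rfl, rfl, fun _ _ _ => rfl⟩
  · simp [block, length]
  · rintro s' ⟨h0, k, h7, hm, hx, hi⟩
    refine ⟨hm, ?_, hi⟩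
    have : k = 0 := by omega
    subst this
    simpa using hx

theorem setup_halts (I : GMSSC) (s : State) (h0 : s.reg = fun _ => 0) (hn : s.mem 0 = I.n)
    (hm : s.mem 1 = I.m) :
    Halts setup s (3 * I.n + 3 * I.m + 14) fun s' => Params I s' ∧ s'.mem = s.mem ∧
      s'.reg 8 = 2 ∧ s'.reg 9 = 0 ∧ s'.reg 11 = 0 ∧ s'.reg 7 = I.m * I.n := by
  -- Register 30 is never written and serves as a permanent zero, so adding it copies a register.
  have A := Halts.of_loopFree (p := block [const 2 1, load 0 30, load 1 2, add 7 0 30])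
    (by simp [block, LoopFree]) s (P := fun s' => s'.reg 0 = I.n ∧ s'.reg 1 = I.m ∧
      s'.reg 2 = 1 ∧ s'.reg 3 = 0 ∧ s'.reg 7 = I.n ∧ s'.reg 30 = 0 ∧ s'.mem = s.mem)
    (by simp [block, eval, h0, hn, hm])
  refine (A.seq (B' := (3 * I.n + 1) + (2 + ((3 * I.m + 1) + 6))) fun s₁ hs₁ => ?_).mono ?_
    fun _ h => h
  rotate_left
  · simp only [block, length]; omega
  obtain ⟨a0, a1, a2, a3, a7, a30, am⟩ := hs₁
  refine Halts.seq ((countdown_halts 3 (by decide) (by decide) (by decide) s₁ a2).mono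
    (by rw [a7]) fun _ h => h) fun s₂ ⟨bm, b3, bi⟩ => ?_
  have b0 := bi 0 (by decide) (by decide)
  have b1 := bi 1 (by decide) (by decide)
  have b2 := bi 2 (by decide) (by decide)
  have b30 := bi 30 (by decide) (by decide)
  rw [a0] at b0; rw [a1] at b1; rw [a2] at b2; rw [a30] at b30; rw [a3, a7, a0] at b3
  have C := Halts.of_loopFree (p := block [const 4 2, add 7 1 30])
    (by simp [block, LoopFree]) s₂ (P := fun s' => s'.reg 0 = I.n ∧ s'.reg 1 = I.m ∧
      s'.reg 2 = 1 ∧ s'.reg 3 = I.n * I.n ∧ s'.reg 4 = 2 ∧ s'.reg 7 = I.m ∧ s'.mem = s.mem)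
    (by simp [block, eval, b0, b1, b2, b3, b30, bm, am])
  refine Halts.seq (C.mono (by simp [block, length]) fun _ h => h) fun s₃ hs₃ => ?_
  obtain ⟨c0, c1, c2, c3, c4, c7, cm⟩ := hs₃
  refine Halts.seq ((countdown_halts 4 (by decide) (by decide) (by decide) s₃ c2).mono
    (by rw [c7]) fun _ h => h) fun s₄ ⟨dm, d4, di⟩ => ?_
  have d0 := di 0 (by decide) (by decide)
  have d1 := di 1 (by decide) (by decide)
  have d2 := di 2 (by decide) (by decide)
  have d3 := di 3 (by decide) (by decide)
  rw [c0] at d0; rw [c1] at d1; rw [c2] at d2; rw [c3] at d3; rw [c4, c7, c0] at d4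
  refine (Halts.of_loopFree (p := block [add 5 4 0, add 6 5 0, const 8 2, const 9 0, const 11 0,
    sub 7 4 8]) (by simp [block, LoopFree]) s₄ ?_).mono (by simp [block, length]) fun _ h => h
  refine ⟨⟨?_, ?_, ?_, ?_, ?_, ?_, ?_⟩, ?_, ?_, ?_, ?_, ?_⟩ <;>
    simp [block, eval, d0, d1, d2, d3, d4, dm, cm, GMSSC.loadBase, GMSSC.tokenBase]

end RAM

namespace RAM

open Program GMSSC

variable {I : GMSSC}

/-- An instruction without a relevant effect. -/
def nop : Program := const 20 0

/-- Programs that do not write to the memory. -/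
def Program.StoreFree : Program → Prop
  | store _ _ => False
  | seq p q => p.StoreFree ∧ q.StoreFree
  | cond _ p q => p.StoreFree ∧ q.StoreFree
  | _ => True

theorem Program.StoreFree.eval_mem {p : Program} (hp : p.StoreFree) (s : State) :
    (p.eval s).mem = s.mem := by
  induction p generalizing s with
  | store x y => exact hp.elim
  | seq p q ihp ihq => exact (ihq hp.2 _).trans (ihp hp.1 s)
  | cond x p q ihp ihq =>
    simp only [eval]
    split_ifs
    · exact ihq hp.2 s
    · exact ihp hp.1 s
  | _ => rfl

/-! ### The initial assignment -/

/-- Looks at an incidence and puts the tokens of its hyperedge there if it is the first one. -/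
def placeStep : Program :=
  block [load 12 8, add 13 6 8, add 14 5 9, load 15 14, add 15 15 3,
    Program.cond 11 nop (Program.cond 12 (block [const 11 1, store 13 3, store 14 15]) nop),
    add 8 8 2, add 9 9 2]

/-- Passes to the next hyperedge if all vertices have been considered. -/
def placeNext : Program :=
  block [sub 16 0 9, Program.cond 16 nop (block [const 9 0, const 11 0]), sub 7 4 8]

/-- The situation before the incidence of hyperedge `e` and vertex `v` is considered. -/
structure Placing (I : GMSSC) (y : Fin I.m → Fin I.n → ℕ) (e v : ℕ) (s : State) : Prop where
  params : Params I s
  holds : I.Holds y (I.load y) s.mem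
  addr : s.reg 8 = 2 + e * I.n + v
  vertex : s.reg 9 = v
  mem_edge : ∀ e v, y e v ≠ 0 → v ∈ I.edge e
  past : ∀ e' : Fin I.m, (e' : ℕ) < e → ∑ v, y e' v = I.n * I.n
  future : ∀ e' : Fin I.m, e < (e' : ℕ) → ∀ v, y e' v = 0
  flag : ∀ e' : Fin I.m, (e' : ℕ) = e →
    (s.reg 11 = 0 ∧ (∀ v, y e' v = 0) ∧ ∀ v' : Fin I.n, (v' : ℕ) < v → v' ∉ I.edge e') ∨
    (s.reg 11 ≠ 0 ∧ ∑ v, y e' v = I.n * I.n)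

/-- Tokens are placed only while the flag in register 11 is 0. The row of `e` is then still zero, so
adding `n²` to the stored load of `v` is correct. -/
theorem Placing.step {y : Fin I.m → Fin I.n → ℕ} {e : Fin I.m} {v : Fin I.n} {s : State}
    (h : Placing I y e v s) : ∃ y', Placing I y' e (v + 1) (placeStep.eval s) := by
  obtain ⟨⟨p0, p1, p2, p3, p4, p5, p6⟩, hm, h8, h9, hsupp, hpast, hfut, hflag⟩ := h
  have hinc := hm.inc e v
  have hld := hm.ld v
  have hf := hflag e rfl
  by_cases hf0 : s.reg 11 = 0
  · replace hf : (∀ v, y e v = 0) ∧ ∀ v' : Fin I.n, (v' : ℕ) < v → v' ∉ I.edge e := by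
      simpa [hf0] using hf
    by_cases hv : v ∈ I.edge e
    · rw [if_pos hv] at hinc
      have hmem : (placeStep.eval s).mem = Function.update (Function.update s.mem
          (I.tokenBase + (2 + e * I.n + v)) (I.n * I.n)) (I.loadBase + v)
          (I.load y v + I.n * I.n) := by
        simp [placeStep, block, eval, State.setMem_mem_eq_update, h8, h9, hf0, hinc, p3, p5, p6,
          hld]
      have hother : ∀ e' : Fin I.m, e' ≠ e → placeTokens (I.n * I.n) y e v e' = y e' := by
        intro e' he'
        ext v'
        simp [placeTokens, he']
      have hsum : ∑ v', placeTokens (I.n * I.n) y e v e v' = I.n * I.n := by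
        simp [placeTokens, hf.1]
      refine ⟨placeTokens (I.n * I.n) y e v, ⟨?_, ?_, ?_, ?_, ?_, ?_, ?_⟩, ?_, ?_, ?_, ?_, ?_, ?_,
        ?_⟩
      any_goals simp [placeStep, block, eval, h8, h9, hf0, hinc, *]
      · rw [funext (load_placeTokens hf.1 v)]
        exact (hm.update_tok e v (I.n * I.n)).update_ld v (I.load y v + I.n * I.n)
      · ring
      · intro e' v' h'
        by_cases hev : e' = e ∧ v' = v
        · rw [hev.1, hev.2]; exact hv
        · exact hsupp e' v' (by simpa [placeTokens, hev] using h')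
      · intro e' he'
        rw [hother e' (by omega)]
        exact hpast e' he'
      · intro e' he' v'
        rw [hother e' (by omega)]
        exact hfut e' he' v'
      · intro e' he'
        rw [Fin.ext he']
        exact hsum
    · rw [if_neg hv] at hinc
      refine ⟨y, ⟨?_, ?_, ?_, ?_, ?_, ?_, ?_⟩, ?_, ?_, ?_, hsupp, hpast, hfut, ?_⟩
      any_goals simp [placeStep, block, eval, nop, h8, h9, hf0, hinc, *]
      · ring
      · intro e' he'
        rw [Fin.ext he']
        refine ⟨hf.1, fun v' hv' => ?_⟩
        rcases Nat.le_iff_lt_or_eq.1 hv' with h | h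
        · exact hf.2 v' h
        · rw [Fin.ext h]; exact hv
  · refine ⟨y, ⟨?_, ?_, ?_, ?_, ?_, ?_, ?_⟩, ?_, ?_, ?_, hsupp, hpast, hfut, ?_⟩
    any_goals simp [placeStep, block, eval, nop, h8, h9, hf0, *]
    · ring
    · intro e' he'
      rw [Fin.ext he']
      simpa [hf0] using hf

/-- At the end of a row `(e, n)` and `(e + 1, 0)` have the same address. Since hyperedges are
nonempty, the tokens of `e` have been placed by then. -/
theorem Placing.next {y : Fin I.m → Fin I.n → ℕ} {e : Fin I.m} {v : ℕ} {s : State} (hv : v ≤ I.n)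
    (h : Placing I y e v s) : ∃ e' v' : ℕ, Placing I y e' v' (placeNext.eval s) ∧
      e' * I.n + v' = e * I.n + v ∧ e' ≤ I.m ∧ (e' < I.m → v' < I.n) ∧ (e' = I.m → v' = 0) ∧
      (placeNext.eval s).reg 7 = I.m * I.n - (e' * I.n + v') := by
  obtain ⟨⟨p0, p1, p2, p3, p4, p5, p6⟩, hm, h8, h9, hsupp, hpast, hfut, hflag⟩ := h
  have hf := hflag e rfl
  have he := e.isLt
  rcases hv.lt_or_eq with hlt | rfl
  · have hsub : I.n - v ≠ 0 := by omega
    refine ⟨e, v, ⟨⟨?_, ?_, ?_, ?_, ?_, ?_, ?_⟩, ?_, ?_, ?_, hsupp, hpast, hfut, ?_⟩, rfl,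
      he.le, fun _ => hlt, fun h => by omega, ?_⟩
    any_goals simp [placeNext, block, eval, nop, *]
    · intro e' he'
      rw [Fin.ext he']
      exact hf
    · omega
  · refine ⟨e + 1, 0, ⟨⟨?_, ?_, ?_, ?_, ?_, ?_, ?_⟩, ?_, ?_, ?_, hsupp, ?_, ?_, ?_⟩, by ring,
      he, fun _ => n_pos_of_edge e, fun _ => rfl, ?_⟩
    any_goals simp [placeNext, block, eval, nop, *]
    · ring
    · intro e' he'
      rcases Nat.le_iff_lt_or_eq.1 he' with h | h
      · exact hpast e' h
      · rw [Fin.ext h]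
        rcases hf with ⟨-, -, hf⟩ | hf
        · obtain ⟨v', hv'⟩ := edge_nonempty e
          exact absurd hv' (hf v' v'.isLt)
        · exact hf.2
    · intro e' he' v'
      exact hfut e' (by omega) v'
    · intro e' he' v'
      exact hfut e' (by omega) v'
    · have : (↑e + 1) * I.n = e * I.n + I.n := by ring
      omega

theorem place_halts {y : Fin I.m → Fin I.n → ℕ} (s : State) (h : Placing I y 0 0 s)
    (h7 : s.reg 7 = I.m * I.n) :
    Halts (loop 7 (.seq placeStep placeNext)) s (21 * (I.m * I.n) + 1) fun s' => Params I s' ∧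
      ∃ y, I.IsAssignment (I.n * I.n) y ∧ I.Holds y (I.load y) s'.mem := by
  refine (Halts.loop (p := .seq placeStep placeNext) ?_ (fun k s' => k = s'.reg 7 ∧
    ∃ y, ∃ e v : ℕ, Placing I y e v s' ∧ e ≤ I.m ∧ (e < I.m → v < I.n) ∧ (e = I.m → v = 0) ∧
    s'.reg 7 = I.m * I.n - (e * I.n + v)) ?_ (I.m * I.n) s ?_).mono ?_ ?_
  · simp [placeStep, placeNext, block, LoopFree, nop]
  · rintro k s' ⟨rfl, y, e, v, hp, hem, hv, hv0, h7'⟩ hne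
    have he : e < I.m := by
      rcases hem.lt_or_eq with h | rfl
      · exact h
      · simp [hv0 rfl] at h7'
        exact absurd h7' hne
    obtain ⟨y', h1⟩ := hp.step (e := ⟨e, he⟩) (v := ⟨v, hv he⟩)
    obtain ⟨e', v', h2, heq, h3, h4, h5, h6⟩ := h1.next (e := ⟨e, he⟩) (hv he)
    refine ⟨_, ?_, rfl, y', e', v', h2, h3, h4, h5, h6⟩
    have := cell_lt he (hv he)
    simp only [eval]
    rw [h6, h7', heq]
    simp only
    omega
  · exact ⟨h7.symm, y, 0, 0, h, Nat.zero_le _, fun h => n_pos_of_edge ⟨0, h⟩, fun _ => rfl,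
      by simpa using h7⟩
  · simp [placeStep, placeNext, block, Program.length, nop]
  · rintro s' ⟨h0, -, -, y', e, v, hp, hem, hv, hv0, h7'⟩
    have he : e = I.m := by
      rcases hem.lt_or_eq with h | h
      · have := cell_lt h (hv h)
        omega
      · exact h
    subst he
    exact ⟨hp.params, y', ⟨hp.mem_edge, fun e => hp.past e e.isLt⟩, hp.holds⟩

/-! ### The local search -/

/-- Loads the data of the current hyperedge and pair of vertices. -/
def lookup : Program :=
  block [add 12 8 9, add 13 6 12, load 14 13, add 15 8 10, load 16 15, add 17 6 15, load 18 17,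
    add 19 5 9, load 21 19, add 22 5 10, load 23 22, sub 24 21 23, sub 24 24 2]

/-- Moves a token and restarts the search. -/
def moveStep : Program :=
  block [sub 14 14 2, store 13 14, add 18 18 2, store 17 18, sub 21 21 2, store 19 21,
    add 23 23 2, store 22 23, const 8 2, const 9 0, const 10 0]

/-- Passes to the next hyperedge and pair of vertices. -/
def advance : Program :=
  block [add 10 10 2, sub 25 0 10, Program.cond 25 nop (block [const 10 0, add 9 9 2, sub 25 0 9,
    Program.cond 25 nop (block [const 9 0, add 8 8 0])])]

/-- Moves a token if this is an improvement, and passes on otherwise. -/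
def searchStep : Program :=
  block [lookup, Program.cond 14 (Program.cond 16 (Program.cond 24 moveStep advance) advance) advance, sub 7 4 8]

/-- The search has arrived at hyperedge `e` and vertices `v` and `w`. -/
structure Searching (I : GMSSC) (e v w : ℕ) (s : State) : Prop where
  params : Params I s
  addr : s.reg 8 = 2 + e * I.n
  source : s.reg 9 = v
  target : s.reg 10 = w
  le : e ≤ I.m
  lt : e < I.m → v < I.n ∧ w < I.n
  zero : e = I.m → v = 0 ∧ w = 0

theorem Searching.lookup {y : Fin I.m → Fin I.n → ℕ} {e : Fin I.m} {v w : Fin I.n} {s : State}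
    (h : Searching I e v w s) (hm : I.Holds y (I.load y) s.mem) :
    Searching I e v w (lookup.eval s) ∧ (lookup.eval s).mem = s.mem ∧
    (lookup.eval s).reg 13 = I.tokenBase + (2 + e * I.n + v) ∧
    (lookup.eval s).reg 14 = y e v ∧
    (lookup.eval s).reg 16 = (if w ∈ I.edge e then 1 else 0) ∧
    (lookup.eval s).reg 17 = I.tokenBase + (2 + e * I.n + w) ∧
    (lookup.eval s).reg 18 = y e w ∧
    (lookup.eval s).reg 19 = I.loadBase + v ∧ (lookup.eval s).reg 21 = I.load y v ∧
    (lookup.eval s).reg 22 = I.loadBase + w ∧ (lookup.eval s).reg 23 = I.load y w ∧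
    (lookup.eval s).reg 24 = I.load y v - I.load y w - 1 := by
  obtain ⟨⟨p0, p1, p2, p3, p4, p5, p6⟩, h8, h9, h10, hle, hlt, hz⟩ := h
  have t1 := hm.tok e v
  have t2 := hm.tok e w
  have i2 := hm.inc e w
  have l1 := hm.ld v
  have l2 := hm.ld w
  refine ⟨⟨⟨?_, ?_, ?_, ?_, ?_, ?_, ?_⟩, ?_, ?_, ?_, hle, hlt, hz⟩, ?_, ?_, ?_, ?_, ?_, ?_, ?_, ?_,
    ?_, ?_, ?_⟩
  all_goals simp [RAM.lookup, block, eval, p0, p1, p2, p3, p4, p5, p6, h8, h9, h10, t1, t2, i2,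
    l1, l2]

theorem advance_mem (s : State) : (advance.eval s).mem = s.mem :=
  StoreFree.eval_mem (by simp [advance, block, StoreFree, nop]) s

/-- The triple `(e, v, w)` is incremented like an odometer; overflow past the last triple leads to
`(m, 0, 0)`, which ends the search. -/
theorem Searching.advance {e v w : ℕ} {s : State} (h : Searching I e v w s) (he : e < I.m) :
    ∃ e' v' w', Searching I e' v' w' (advance.eval s) ∧
      (e' * I.n + v') * I.n + w' = (e * I.n + v) * I.n + w + 1 := by
  obtain ⟨⟨p0, p1, p2, p3, p4, p5, p6⟩, h8, h9, h10, hle, hlt, hz⟩ := h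
  obtain ⟨hv, hw⟩ := hlt he
  by_cases hw' : w + 1 < I.n
  · have hsub : I.n - (w + 1) ≠ 0 := by omega
    refine ⟨e, v, w + 1, ⟨⟨?_, ?_, ?_, ?_, ?_, ?_, ?_⟩, ?_, ?_, ?_, hle, fun _ => ⟨hv, hw'⟩,
      fun h => by omega⟩, by ring⟩
    all_goals simp [RAM.advance, block, eval, nop, p0, p1, p2, p3, p4, p5, p6, h8, h9, h10, hsub]
  · have hsub : I.n - (w + 1) = 0 := by omega
    by_cases hv' : v + 1 < I.n
    · have hsub' : I.n - (v + 1) ≠ 0 := by omega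
      refine ⟨e, v + 1, 0, ⟨⟨?_, ?_, ?_, ?_, ?_, ?_, ?_⟩, ?_, ?_, ?_, hle,
        fun _ => ⟨hv', by omega⟩, fun h => by omega⟩, ?_⟩
      any_goals simp [RAM.advance, block, eval, nop, p0, p1, p2, p3, p4, p5, p6, h8, h9, h10,
        hsub, hsub']
      have : (e * I.n + (v + 1)) * I.n = (e * I.n + v) * I.n + I.n := by ring
      omega
    · have hsub' : I.n - (v + 1) = 0 := by omega
      refine ⟨e + 1, 0, 0, ⟨⟨?_, ?_, ?_, ?_, ?_, ?_, ?_⟩, ?_, ?_, ?_, he,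
        fun _ => ⟨by omega, by omega⟩, fun _ => ⟨rfl, rfl⟩⟩, ?_⟩
      any_goals simp [RAM.advance, block, eval, nop, p0, p1, p2, p3, p4, p5, p6, h8, h9, h10,
        hsub, hsub']
      · ring
      · have h1 : I.n = v + 1 := by omega
        have h2 : w = v := by omega
        rw [h1, h2]
        ring

/-- No improvement is possible before position `N` in the order of the search. -/
def Scanned (I : GMSSC) (y : Fin I.m → Fin I.n → ℕ) (N : ℕ) : Prop :=
  ∀ (e : Fin I.m) (v w : Fin I.n), (e * I.n + v) * I.n + w < N → ¬ I.Improvable y e v w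

theorem Scanned.succ {y : Fin I.m → Fin I.n → ℕ} {e : Fin I.m} {v w : Fin I.n}
    (h : Scanned I y ((e * I.n + v) * I.n + w)) (hi : ¬ I.Improvable y e v w) :
    Scanned I y ((e * I.n + v) * I.n + w + 1) := by
  intro e' v' w' hlt
  rcases Nat.lt_succ_iff_lt_or_eq.1 hlt with h' | h'
  · exact h e' v' w' h'
  · obtain ⟨h1, h2⟩ := (cell_inj w'.isLt w.isLt).1 h'
    obtain ⟨h3, h4⟩ := (cell_inj v'.isLt v.isLt).1 h1
    rw [Fin.ext h2, Fin.ext h3, Fin.ext h4]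
    exact hi

/-- Either the potential drops and the scan restarts at the origin, where `Scanned` is vacuous, or
the assignment is unchanged and the scan moves one position further. -/
theorem Searching.step {y : Fin I.m → Fin I.n → ℕ} {e : Fin I.m} {v w : Fin I.n} {s : State}
    (h : Searching I e v w s) (hy : I.IsAssignment (I.n * I.n) y)
    (hm : I.Holds y (I.load y) s.mem) (hs : Scanned I y ((e * I.n + v) * I.n + w)) :
    ∃ y' e' v' w', Searching I e' v' w' (searchStep.eval s) ∧ I.IsAssignment (I.n * I.n) y' ∧
      I.Holds y' (I.load y') (searchStep.eval s).mem ∧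
      Scanned I y' ((e' * I.n + v') * I.n + w') ∧
      (searchStep.eval s).reg 7 = I.m * I.n - e' * I.n ∧
      (∑ v, I.load y' v ^ 2 < ∑ v, I.load y v ^ 2 ∨ y' = y ∧
        (e' * I.n + v') * I.n + w' = (e * I.n + v) * I.n + w + 1) := by
  obtain ⟨h1, hmem, r13, r14, r16, r17, r18, r19, r21, r22, r23, r24⟩ := h.lookup hm
  set s₁ := RAM.lookup.eval s with hs₁
  by_cases hi : I.Improvable y e v w
  · have heval : searchStep.eval s = (moveStep.eval s₁).setReg 7
        ((moveStep.eval s₁).reg 4 - (moveStep.eval s₁).reg 8) := by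
      -- With truncated subtraction, register 24 is nonzero exactly when the loads differ by at
      -- least 2 in the right direction.
      have h24 : I.load y v - I.load y w - 1 ≠ 0 := by have := hi.2.2; omega
      simp [searchStep, block, eval, ← hs₁, r14, r16, r24, hi.1, hi.2.1, h24]
    obtain ⟨⟨p0, p1, p2, p3, p4, p5, p6⟩, h8, h9, h10, hle, hlt, hz⟩ := h1
    have hmem' : (moveStep.eval s₁).mem =
        Function.update (Function.update (Function.update (Function.update s.mem
          (I.tokenBase + (2 + e * I.n + v)) (y e v - 1))
          (I.tokenBase + (2 + e * I.n + w)) (y e w + 1))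
          (I.loadBase + v) (I.load y v - 1))
          (I.loadBase + w) (I.load y w + 1) := by
      simp only [moveStep, block, eval, State.setMem_mem_eq_update, State.setReg_mem,
        State.setReg_reg, State.setMem_reg, r13, r14, r17, r18, r19, r21, r22, r23, p2, hmem,
        reduceIte, Nat.reduceEqDiff]
    have hm' : I.Holds (moveToken y e v w) (I.load (moveToken y e v w))
        (searchStep.eval s).mem := by
      rw [heval, State.setReg_mem, hmem']
      exact hm.moveToken hi
    refine ⟨moveToken y e v w, 0, 0, 0, ⟨⟨?_, ?_, ?_, ?_, ?_, ?_, ?_⟩, ?_, ?_, ?_, Nat.zero_le _,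
      fun _ => ⟨v.pos, v.pos⟩, fun _ => ⟨rfl, rfl⟩⟩, hy.moveToken hi, hm', ?_, ?_,
      Or.inl (sum_sq_load_moveToken_lt hi)⟩
    any_goals rw [heval]
    any_goals simp [moveStep, block, eval, p0, p1, p2, p3, p4, p5, p6]
    · intro e' v' w' hlt
      simp at hlt
  · have heval : searchStep.eval s = (RAM.advance.eval s₁).setReg 7
        ((RAM.advance.eval s₁).reg 4 - (RAM.advance.eval s₁).reg 8) := by
      by_cases h14 : y e v = 0
      · simp [searchStep, block, eval, ← hs₁, r14, h14]
      by_cases h16 : w ∈ I.edge e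
      · have h24 : I.load y v - I.load y w - 1 = 0 := by
          simp only [Improvable, h14, h16] at hi
          simp at hi
          omega
        simp [searchStep, block, eval, ← hs₁, r14, h14, r16, h16, r24, h24]
      · simp [searchStep, block, eval, ← hs₁, r14, h14, r16, h16]
    obtain ⟨e', v', w', h2, hidx⟩ := h1.advance e.isLt
    have hmem' : (RAM.advance.eval s₁).mem = s.mem := by rw [advance_mem, hmem]
    set s₂ := RAM.advance.eval s₁
    obtain ⟨⟨p0, p1, p2, p3, p4, p5, p6⟩, h8, h9, h10, hle, hlt, hz⟩ := h2
    refine ⟨y, e', v', w', ⟨⟨?_, ?_, ?_, ?_, ?_, ?_, ?_⟩, ?_, ?_, ?_, hle, hlt, hz⟩, hy, ?_,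
      hidx ▸ hs.succ hi, ?_, Or.inr ⟨rfl, hidx⟩⟩
    all_goals rw [heval]
    any_goals simp [p0, p1, p2, p3, p4, p5, p6, h8, h9, h10]
    · rw [hmem']; exact hm
    · omega

end RAM

namespace RAM

open Program GMSSC

variable {I : GMSSC}

theorem searchStep_length : searchStep.length + 1 = 62 := by
  simp [searchStep, lookup, moveStep, advance, block, Program.length, nop]

/-- The measure is lexicographic: potential times `mn² + 1`, plus the number of positions left. One
unit of potential thus outweighs a complete rescan. -/
theorem search_halts {y : Fin I.m → Fin I.n → ℕ} (s : State) (h : Searching I 0 0 0 s)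
    (hy : I.IsAssignment (I.n * I.n) y) (hm : I.Holds y (I.load y) s.mem)
    (h7 : s.reg 7 = I.m * I.n) :
    Halts (loop 7 searchStep) s
      (62 * ((I.m * (I.n * I.n)) ^ 2 * (I.m * I.n * I.n + 1) + I.m * I.n * I.n) + 1)
      fun s' => Params I s' ∧ ∃ y, I.IsAssignment (I.n * I.n) y ∧
        (∀ e v w, ¬ I.Improvable y e v w) ∧ I.Holds y (I.load y) s'.mem := by
  have hN : ∀ {e v w : ℕ}, e < I.m → v < I.n ∧ w < I.n →
      (e * I.n + v) * I.n + w < I.m * I.n * I.n := fun he hvw =>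
    cell_lt (cell_lt he hvw.1) hvw.2
  refine (Halts.loop (p := searchStep) ?_ (fun k s' => ∃ y e v w, Searching I e v w s' ∧
    I.IsAssignment (I.n * I.n) y ∧ I.Holds y (I.load y) s'.mem ∧
    Scanned I y ((e * I.n + v) * I.n + w) ∧ s'.reg 7 = I.m * I.n - e * I.n ∧
    k = (∑ v, I.load y v ^ 2) * (I.m * I.n * I.n + 1) +
      (I.m * I.n * I.n - ((e * I.n + v) * I.n + w))) ?_ _ s
    ⟨y, 0, 0, 0, h, hy, hm, fun e v w hlt => by simp at hlt, by simpa using h7, rfl⟩).mono ?_ ?_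
  · simp [searchStep, lookup, moveStep, advance, block, LoopFree, nop]
  · rintro k s' ⟨y, e, v, w, hs, hy, hm, hsc, h7', rfl⟩ hne
    have he : e < I.m := by
      rcases hs.le.lt_or_eq with h | rfl
      · exact h
      · simp [h7'] at hne
    obtain ⟨hv, hw⟩ := hs.lt he
    obtain ⟨y', e', v', w', h1, h2, h3, h4, h5, h6⟩ :=
      Searching.step (e := ⟨e, he⟩) (v := ⟨v, hv⟩) (w := ⟨w, hw⟩) hs hy hm hsc
    refine ⟨_, ?_, y', e', v', w', h1, h2, h3, h4, h5, rfl⟩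
    rcases h6 with h6 | ⟨rfl, h6⟩
    · have h8 := Nat.mul_le_mul_right (I.m * I.n * I.n + 1) (Nat.succ_le_of_lt h6)
      rw [Nat.succ_eq_add_one, add_mul, one_mul] at h8
      omega
    · have := hN he ⟨hv, hw⟩
      rw [h6]
      simp only
      omega
  · have := Nat.mul_le_mul_right (I.m * I.n * I.n + 1) (sum_sq_load_le hy)
    rw [searchStep_length]
    simp only [zero_mul, zero_add, Nat.sub_zero]
    omega
  · rintro s' ⟨h0, -, y, e, v, w, hs, hy, hm, hsc, h7', -⟩
    have he : e = I.m := by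
      rcases hs.le.lt_or_eq with h | h
      · have := cell_lt h (hs.lt h).1
        have := cell_lt h (n_pos_of_edge ⟨e, h⟩)
        omega
      · exact h
    subst he
    obtain ⟨rfl, rfl⟩ := hs.zero rfl
    exact ⟨hs.params, y, hy, fun e v w => hsc e v w (hN e.isLt ⟨v.isLt, w.isLt⟩), hm⟩

/-- Programs that do not write to register `i`. -/
def Program.Keeps (i : ℕ) : Program → Prop
  | const x _ => i ≠ x
  | add x _ _ => i ≠ x
  | sub x _ _ => i ≠ x
  | load x _ => i ≠ x
  | seq p q => p.Keeps i ∧ q.Keeps i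
  | cond _ p q => p.Keeps i ∧ q.Keeps i
  | _ => True

theorem Program.Keeps.eval_reg {p : Program} {i : ℕ} (hp : p.Keeps i) (s : State) :
    (p.eval s).reg i = s.reg i := by
  induction p generalizing s with
  | seq p q ihp ihq => exact (ihq hp.2 _).trans (ihp hp.1 s)
  | cond x p q ihp ihq =>
    simp only [eval]
    split_ifs
    · exact ihq hp.2 s
    · exact ihp hp.1 s
  | store => rfl
  | loop => rfl
  | _ => simp only [eval, State.setReg_reg, if_neg hp]

theorem Params.eval {p : Program} {s : State} (h : Params I s) (hp : ∀ i < 7, p.Keeps i) :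
    Params I (p.eval s) := by
  constructor <;> rw [(hp _ (by norm_num)).eval_reg]
  exacts [h.n, h.m, h.one, h.tokens, h.incEnd, h.loads, h.offset]

/-! ### Sorting the vertices -/

/-- Compares two vertices. -/
def rankStep : Program :=
  block [add 12 5 8, load 13 12, add 14 5 9, load 15 14, sub 16 15 13, sub 17 13 15, sub 18 8 9,
    Program.cond 16 (add 11 11 2) (Program.cond 17 nop (Program.cond 18 (add 11 11 2) nop)),
    add 9 9 2]

/-- Outputs a vertex if it has been compared with all vertices. -/
def rankNext : Program :=
  block [sub 19 0 9, Program.cond 19 nop (block [store 11 8, const 11 0, const 9 0, add 8 8 2]),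
    sub 7 0 8]

/-- The situation before the vertices `v` and `w` are compared. -/
structure Ranking (I : GMSSC) (l : Fin I.n → ℕ) (v w : ℕ) (s : State) : Prop where
  params : Params I s
  vertex : s.reg 8 = v
  other : s.reg 9 = w
  count : ∀ v' : Fin I.n, (v' : ℕ) = v →
    s.reg 11 = #{w' : Fin I.n | (w' : ℕ) < w ∧ Before l w' v'}
  loads : ∀ v : Fin I.n, s.mem (I.loadBase + v) = l v
  output : ∀ v' : Fin I.n, (v' : ℕ) < v → s.mem (rank l v') = v'

theorem card_before_succ (l : Fin I.n → ℕ) (v w : Fin I.n) :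
    #{w' : Fin I.n | (w' : ℕ) < w + 1 ∧ Before l w' v} =
      #{w' : Fin I.n | (w' : ℕ) < w ∧ Before l w' v} + if Before l w v then 1 else 0 := by
  split_ifs with h
  · rw [← Finset.card_insert_of_notMem (a := w) (by simp)]
    congr 1
    ext x
    simp only [mem_filter, mem_univ, true_and, mem_insert]
    constructor
    · rintro ⟨h1, h2⟩
      by_cases hx : x = w
      · exact Or.inl hx
      · have := Fin.val_ne_of_ne hx
        exact Or.inr ⟨by omega, h2⟩
    · rintro (rfl | ⟨h1, h2⟩)
      · exact ⟨by omega, h⟩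
      · exact ⟨by omega, h2⟩
  · rw [add_zero]
    congr 1
    ext x
    simp only [mem_filter, mem_univ, true_and]
    constructor
    · rintro ⟨h1, h2⟩
      have hx : x ≠ w := by rintro rfl; exact h h2
      have := Fin.val_ne_of_ne hx
      exact ⟨by omega, h2⟩
    · rintro ⟨h1, h2⟩
      exact ⟨by omega, h2⟩

theorem Ranking.step {l : Fin I.n → ℕ} {v w : Fin I.n} {s : State} (h : Ranking I l v w s) :
    Ranking I l v (w + 1) (rankStep.eval s) := by
  obtain ⟨hp, h8, h9, hc, hl, ho⟩ := h
  have p2 := hp.one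
  have p5 := hp.loads
  have hmem : (rankStep.eval s).mem = s.mem :=
    StoreFree.eval_mem (by simp [rankStep, block, StoreFree, nop]) s
  have lv := hl v
  have lw := hl w
  have hc' := hc v rfl
  have hcase : (rankStep.eval s).reg 11 = s.reg 11 + (if Before l w v then 1 else 0) ∧
      (rankStep.eval s).reg 9 = w + 1 := by
    rcases lt_trichotomy (l v) (l w) with h | h | h
    · have h16 : l w - l v ≠ 0 := by omega
      simp [rankStep, block, eval, p2, p5, h8, h9, lv, lw, h16, Before, h]
    · by_cases hlt : w < v
      · have h18 : (v : ℕ) - w ≠ 0 := by omega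
        simp [rankStep, block, eval, p2, p5, h8, h9, lv, lw, h18, Before, h, hlt]
      · have h18 : (v : ℕ) - w = 0 := by omega
        simp [rankStep, block, eval, p2, p5, h8, h9, lv, lw, h18, Before, h, hlt, nop]
    · have h16 : l w - l v = 0 := by omega
      have h17 : l v - l w ≠ 0 := by omega
      have hb : ¬ (l v < l w ∨ l v = l w ∧ w < v) := by omega
      simp [rankStep, block, eval, p2, p5, h8, h9, lv, lw, h16, h17, Before, hb, nop]
  refine ⟨hp.eval fun i hi => ?_, ?_, hcase.2, fun v' hv' => ?_, hmem ▸ hl, hmem ▸ ho⟩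
  · simp only [rankStep, block, nop, Keeps]
    omega
  · rw [Keeps.eval_reg (by simp [rankStep, block, nop, Keeps]), h8]
  · rw [Fin.ext hv', hcase.1, card_before_succ, hc']

theorem Ranking.next {l : Fin I.n → ℕ} {v : Fin I.n} {w : ℕ} {s : State} (hw : w ≤ I.n)
    (h : Ranking I l v w s) : ∃ v' w' : ℕ, Ranking I l v' w' (rankNext.eval s) ∧
      v' * I.n + w' = v * I.n + w ∧ v' ≤ I.n ∧ w' < I.n ∧ (v' = I.n → w' = 0) ∧
      (rankNext.eval s).reg 7 = I.n - v' := by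
  obtain ⟨⟨p0, p1, p2, p3, p4, p5, p6⟩, h8, h9, hc, hl, ho⟩ := h
  have hv := v.isLt
  rcases hw.lt_or_eq with hlt | rfl
  · have hsub : I.n - w ≠ 0 := by omega
    refine ⟨v, w, ⟨⟨?_, ?_, ?_, ?_, ?_, ?_, ?_⟩, ?_, ?_, ?_, ?_, ?_⟩, rfl, hv.le, hlt,
      fun h => by omega, ?_⟩
    any_goals simp [rankNext, block, eval, nop, hsub, *]
    exacts [hc, ho]
  · have hc' : s.reg 11 = rank l v := by
      rw [hc v rfl, rank]
      simp
    have hmem : (rankNext.eval s).mem = Function.update s.mem (rank l v) v := by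
      simp [rankNext, block, eval, nop, p0, p2, h8, h9, hc', State.setMem_mem_eq_update]
    refine ⟨v + 1, 0, ⟨⟨?_, ?_, ?_, ?_, ?_, ?_, ?_⟩, ?_, ?_, ?_, ?_, ?_⟩, by ring, hv, v.pos,
      fun _ => rfl, ?_⟩
    case refine_11 =>
      intro v'
      rw [hmem, Function.update_of_ne, hl]
      -- The output may overwrite the input, since `n` is kept in register 0. The gap of `n` cells
      -- in `loadBase` keeps it away from the loads even when `m = 0`.
      have := rank_lt l v
      simp only [loadBase]
      omega
    case refine_12 =>
      intro v' hv'
      rw [hmem]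
      rcases Nat.lt_succ_iff_lt_or_eq.1 hv' with h | h
      · rw [Function.update_of_ne, ho v' h]
        intro heq
        have := rank_injective l heq
        subst this
        exact lt_irrefl _ h
      · rw [Fin.ext h, Function.update_self]
    all_goals simp [rankNext, block, eval, nop, p0, p1, p2, p3, p4, p5, p6, h8, h9]

theorem rank_halts {l : Fin I.n → ℕ} (s : State) (h : Ranking I l 0 0 s)
    (h7 : s.reg 7 = I.n) :
    Halts (loop 7 (.seq rankStep rankNext)) s (24 * (I.n * I.n) + 1) fun s' =>
      ∀ v : Fin I.n, s'.mem (rank l v) = v := by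
  refine (Halts.loop (p := .seq rankStep rankNext) ?_ (fun k s' => ∃ v w : ℕ,
    Ranking I l v w s' ∧ v ≤ I.n ∧ (v < I.n → w < I.n) ∧
    s'.reg 7 = I.n - v ∧ k = I.n * I.n - (v * I.n + w)) ?_ (I.n * I.n) s
    ⟨0, 0, h, Nat.zero_le _, fun h => h, by simpa using h7, by simp⟩).mono ?_ ?_
  · simp [rankStep, rankNext, block, LoopFree, nop]
  · rintro k s' ⟨v, w, hr, hv, hw, h7', rfl⟩ hne
    have hv' : v < I.n := by omega
    obtain ⟨v', w', h2, heq, h3, h4, h5, h6⟩ :=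
      (Ranking.step (v := ⟨v, hv'⟩) (w := ⟨w, hw hv'⟩) hr).next (hw hv')
    refine ⟨_, ?_, v', w', h2, h3, fun _ => h4, h6, rfl⟩
    have := cell_lt hv' (hw hv')
    rw [heq]
    simp only
    omega
  · simp [rankStep, rankNext, block, Program.length, nop]
  · rintro s' ⟨h0, -, v, w, hr, hv, hw, h7', -⟩ v'
    exact hr.output v' (by omega)

/-! ### The algorithm -/

/-- Balances the loads of the vertices by local search and sorts the vertices by decreasing
loads. -/
def balanceAndSort : Program :=
  block [setup, loop 7 (.seq placeStep placeNext),
    block [const 8 2, const 9 0, const 10 0, sub 7 4 8], loop 7 searchStep,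
    block [const 8 0, const 9 0, const 11 0, sub 7 0 8], loop 7 (.seq rankStep rankNext)]

theorem input_incidence (I : GMSSC) (e : Fin I.m) (v : Fin I.n) :
    (input I).mem (2 + e * I.n + v) = if v ∈ I.edge e then 1 else 0 := by
  have h0 : 2 + (e : ℕ) * I.n + v ≠ 0 := by omega
  have h1 : 2 + (e : ℕ) * I.n + v ≠ 1 := by omega
  simp only [input, h0, h1, if_false]
  refine if_congr ⟨?_, fun h => ⟨e, v, h, rfl⟩⟩ rfl rfl
  rintro ⟨j, w, hw, heq⟩
  obtain ⟨h2, h3⟩ := (cell_inj v.isLt w.isLt).1 (by omega : (e : ℕ) * I.n + v = j * I.n + w)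
  rw [Fin.ext h2, Fin.ext h3]
  exact hw

theorem input_eq_zero (I : GMSSC) {c : ℕ} (hc : 2 + I.m * I.n ≤ c) : (input I).mem c = 0 := by
  have h0 : c ≠ 0 := by omega
  have h1 : c ≠ 1 := by omega
  simp only [input, h0, h1, if_false]
  rw [if_neg]
  rintro ⟨j, w, -, heq⟩
  have := cell_lt j.isLt w.isLt
  omega

theorem holds_input (I : GMSSC) : I.Holds 0 (I.load 0) (input I).mem := by
  refine ⟨input_incidence I, fun e v => ?_, fun v => ?_⟩
  · rw [input_eq_zero]
    · rfl
    · simp only [tokenBase, loadBase]; omega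
  · rw [input_eq_zero]
    · simp [GMSSC.load]
    · simp only [loadBase]; omega

theorem balanceAndSort_halts (I : GMSSC) (hI : I.IsMinLatency) :
    Halts balanceAndSort (input I)
      ((3 * I.n + 3 * I.m + 14) + ((21 * (I.m * I.n) + 1) + (4 +
        ((62 * ((I.m * (I.n * I.n)) ^ 2 * (I.m * I.n * I.n + 1) + I.m * I.n * I.n) + 1) +
        (4 + (24 * (I.n * I.n) + 1))))))
      fun s => ∃ σ : I.Ordering, Outputs s σ ∧ I.cost σ ≤ 2 * I.opt := by
  refine (setup_halts I (input I) rfl (by simp [input]) (by simp [input])).seq ?_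
  rintro s₁ ⟨hp, hm, h8, h9, h11, h7⟩
  refine (place_halts (y := 0) s₁ ⟨hp, by rw [hm]; exact holds_input I, by simpa using h8, h9,
    by simp, by simp, by simp, fun e' he' => Or.inl ⟨h11, by simp, by simp⟩⟩ h7).seq ?_
  rintro s₂ ⟨⟨p0, p1, p2, p3, p4, p5, p6⟩, y, hy, hm⟩
  refine Halts.seq ((Halts.of_loopFree (p := block [const 8 2, const 9 0, const 10 0, sub 7 4 8])
    (by simp [block, LoopFree]) s₂ (P := fun s => Searching I 0 0 0 s ∧
      I.Holds y (I.load y) s.mem ∧ s.reg 7 = I.m * I.n) ?_).mono (by simp [block, Program.length])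
    fun _ h => h) ?_
  · refine ⟨⟨⟨?_, ?_, ?_, ?_, ?_, ?_, ?_⟩, ?_, ?_, ?_, Nat.zero_le _,
      fun h => ⟨n_pos_of_edge ⟨0, h⟩, n_pos_of_edge ⟨0, h⟩⟩, fun _ => ⟨rfl, rfl⟩⟩, ?_, ?_⟩
    all_goals simp [block, eval, p0, p1, p2, p3, p4, p5, p6, hm]
  rintro s₃ ⟨hs, hm, h7⟩
  refine (search_halts s₃ hs hy hm h7).seq ?_
  rintro s₄ ⟨⟨p0, p1, p2, p3, p4, p5, p6⟩, y, hy, hbal, hm⟩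
  refine Halts.seq ((Halts.of_loopFree (p := block [const 8 0, const 9 0, const 11 0, sub 7 0 8])
    (by simp [block, LoopFree]) s₄ (P := fun s => Ranking I (I.load y) 0 0 s ∧
      s.reg 7 = I.n) ?_).mono (by simp [block, Program.length]) fun _ h => h) ?_
  · refine ⟨⟨⟨?_, ?_, ?_, ?_, ?_, ?_, ?_⟩, ?_, ?_, ?_, ?_, ?_⟩, ?_⟩
    all_goals simp [block, eval, p0, p1, p2, p3, p4, p5, p6, hm.ld]
  rintro s₅ ⟨hr, h7⟩
  refine (rank_halts s₅ hr h7).mono le_rfl fun s hs => ?_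
  obtain ⟨σ, hσ⟩ := exists_ordering_symm_eq_rank (I.load y)
  refine ⟨σ, fun i => ?_, cost_le_two_mul_opt hI hy hbal σ fun v w hlt => ?_⟩
  · have := hs (σ i)
    rwa [← hσ, Equiv.symm_apply_apply] at this
  · rw [Fin.lt_def, hσ, hσ]
    exact rank_lt_rank (Or.inl hlt)

theorem isMinLatencyApprox_balanceAndSort : IsMinLatencyApprox balanceAndSort 2 := by
  -- The dominant term `(mn²)² · mn²` has degree 9, and 300 exceeds the sum of all coefficients.
  refine ⟨300, 9, fun I hI => ?_⟩
  obtain ⟨T, s, he, hT, σ, ho, hc⟩ := balanceAndSort_halts I hI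
  refine ⟨T, s, σ, he, hT.trans ?_, ho, by exact_mod_cast hc⟩
  set N := I.n + I.m + 1 with hN
  have hn : I.n ≤ N := by omega
  have hm : I.m ≤ N := by omega
  have h1 : 1 ≤ N := by omega
  have hpow : ∀ k ≤ 9, N ^ k ≤ N ^ 9 := fun k hk => Nat.pow_le_pow_right h1 hk
  have e1 : I.n ≤ N ^ 9 := hn.trans (by simpa using hpow 1 (by norm_num))
  have e2 : I.m ≤ N ^ 9 := hm.trans (by simpa using hpow 1 (by norm_num))
  have e3 : I.m * I.n ≤ N ^ 9 := (Nat.mul_le_mul hm hn).trans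
    (by simpa [sq] using hpow 2 (by norm_num))
  have e4 : I.n * I.n ≤ N ^ 9 := (Nat.mul_le_mul hn hn).trans
    (by simpa [sq] using hpow 2 (by norm_num))
  have e5 : I.m * I.n * I.n ≤ N ^ 9 :=
    (Nat.mul_le_mul (Nat.mul_le_mul hm hn) hn).trans
      (by simpa [pow_succ] using hpow 3 (by norm_num))
  have e6 : (I.m * (I.n * I.n)) ^ 2 * (I.m * I.n * I.n) ≤ N ^ 9 := by
    calc _ ≤ (N * (N * N)) ^ 2 * (N * N * N) := by gcongr
      _ = N ^ 9 := by ring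
  have e7 : (I.m * (I.n * I.n)) ^ 2 ≤ N ^ 9 := by
    calc _ ≤ (N * (N * N)) ^ 2 := by gcongr
      _ = N ^ 6 := by ring
      _ ≤ N ^ 9 := hpow 6 (by norm_num)
  have e8 : 1 ≤ N ^ 9 := Nat.one_le_pow _ _ h1
  rw [mul_add ((I.m * (I.n * I.n)) ^ 2), mul_one]
  omega

end RAM

namespace GMSSC

variable {I : GMSSC}

/-! ### Existence of an optimal solution -/

theorem continuous_prefixSum {X : Type*} [TopologicalSpace X] {f : X → ℕ → ℝ} (hf : Continuous f)
    (t : ℕ) : Continuous fun p => prefixSum (f p) t :=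
  continuous_finsetSum _ fun s _ => (continuous_apply s).comp hf

/-- Each constraint involves only finitely many coordinates, so it is closed in the product
topology. -/
theorem isClosed_lpFeasible (I : GMSSC) :
    IsClosed {p : (Fin I.n → ℕ → ℝ) × (Fin I.m → ℕ → ℝ) | I.LPFeasible p.1 p.2} := by
  have : {p : (Fin I.n → ℕ → ℝ) × (Fin I.m → ℕ → ℝ) | I.LPFeasible p.1 p.2} =
      {p | ∀ v t, 1 ≤ t → 0 ≤ p.1 v t} ∩ {p | ∀ j t, 1 ≤ t → 0 ≤ p.2 j t} ∩
      {p | ∀ t, 1 ≤ t → ∑ v, p.1 v t ≤ 1} ∩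
      {p | ∀ j t, 1 ≤ t → ∀ S ⊆ I.edge j, #S < I.demand j → ((I.demand j : ℝ) - #S) ≤
        ((I.demand j : ℝ) - #S) * p.2 j t + ∑ v ∈ I.edge j \ S, prefixSum (p.1 v) t} := by
    ext p
    exact ⟨fun h => ⟨⟨⟨h.1, h.2⟩, h.3⟩, h.4⟩, fun h => ⟨h.1.1.1, h.1.1.2, h.1.2, h.2⟩⟩
  rw [this]
  simp only [Set.ofPred_forall]
  refine ((IsClosed.inter ?_ ?_).inter ?_).inter ?_
  · exact isClosed_iInter fun v => isClosed_iInter fun t => isClosed_iInter fun _ =>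
      isClosed_le continuous_const (by fun_prop)
  · exact isClosed_iInter fun v => isClosed_iInter fun t => isClosed_iInter fun _ =>
      isClosed_le continuous_const (by fun_prop)
  · exact isClosed_iInter fun t => isClosed_iInter fun _ =>
      isClosed_le (by fun_prop) continuous_const
  · refine isClosed_iInter fun j => isClosed_iInter fun t => isClosed_iInter fun _ =>
      isClosed_iInter fun S => isClosed_iInter fun _ => isClosed_iInter fun _ =>
      isClosed_le continuous_const (Continuous.add (by fun_prop) ?_)
    exact continuous_finsetSum _ fun v _ => continuous_prefixSum (by fun_prop) t

/-- Mass may escape to infinite time in a limit, so only lower semicontinuity is available; it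
suffices for a minimum on a compact set. -/
theorem lowerSemicontinuous_lpCost (I : GMSSC) :
    LowerSemicontinuous fun p : (Fin I.n → ℕ → ℝ) × (Fin I.m → ℕ → ℝ) => I.lpCost p.2 := by
  refine lowerSemicontinuous_sum fun j _ => lowerSemicontinuous_tsum fun t => ?_
  exact (ENNReal.continuous_ofReal.comp (by fun_prop)).lowerSemicontinuous

theorem LPFeasible.x_le_one {x : Fin I.n → ℕ → ℝ} {u : Fin I.m → ℕ → ℝ} (h : I.LPFeasible x u)
    (v : Fin I.n) {t : ℕ} (ht : 1 ≤ t) : x v t ≤ 1 :=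
  (Finset.single_le_sum (f := fun v => x v t) (fun w _ => h.x_nonneg w t ht) (mem_univ v)).trans
    (h.capacity t ht)

theorem prefixSum_congr {f g : ℕ → ℝ} (h : ∀ t, 1 ≤ t → f t = g t) (t : ℕ) :
    prefixSum f t = prefixSum g t :=
  Finset.sum_congr rfl fun s hs => h s (mem_Ico.1 hs).1

theorem prefixSum_nonneg {f : ℕ → ℝ} (h : ∀ t, 1 ≤ t → 0 ≤ f t) (t : ℕ) : 0 ≤ prefixSum f t :=
  Finset.sum_nonneg fun s hs => h s (mem_Ico.1 hs).1

/-- Every feasible solution is dominated by one in the unit cube. -/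
theorem LPFeasible.exists_mem_cube {x : Fin I.n → ℕ → ℝ} {u : Fin I.m → ℕ → ℝ}
    (h : I.LPFeasible x u) : ∃ x' u', I.LPFeasible x' u' ∧ I.lpCost u' ≤ I.lpCost u ∧
      (∀ v t, x' v t ∈ Set.Icc (0 : ℝ) 1) ∧ ∀ j t, u' j t ∈ Set.Icc (0 : ℝ) 1 := by
  -- Time 0 is unconstrained and is set to 0. Truncating `u` at 1 is harmless, since `u = 1` already
  -- satisfies every knapsack cover inequality.
  refine ⟨fun v t => if 1 ≤ t then x v t else 0, fun j t => if 1 ≤ t then min (u j t) 1 else 0,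
    ⟨?_, ?_, ?_, ?_⟩, ?_, ?_, ?_⟩
  · intro v t ht
    simpa [ht] using h.x_nonneg v t ht
  · intro j t ht
    simpa [ht] using h.u_nonneg j t ht
  · intro t ht
    simpa [ht] using h.capacity t ht
  · intro j t ht S hS hcard
    have hpos : (0 : ℝ) ≤ (I.demand j : ℝ) - #S := by
      have : (#S : ℝ) ≤ I.demand j := by exact_mod_cast hcard.le
      linarith
    have hpre : ∀ v, prefixSum (fun t => if 1 ≤ t then x v t else 0) t = prefixSum (x v) t :=
      fun v => prefixSum_congr (fun t ht => by simp [ht]) t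
    simp only [hpre, ht, if_true]
    rcases le_total (u j t) 1 with hu | hu
    · rw [min_eq_left hu]
      exact h.knapsackCover j t ht S hS hcard
    · rw [min_eq_right hu, mul_one, le_add_iff_nonneg_right]
      exact Finset.sum_nonneg fun v _ => prefixSum_nonneg (h.x_nonneg v) t
  · refine Finset.sum_le_sum fun j _ => ENNReal.tsum_le_tsum fun t => ENNReal.ofReal_le_ofReal ?_
    simp
  · intro v t
    by_cases ht : 1 ≤ t
    · simpa [ht] using ⟨h.x_nonneg v t ht, h.x_le_one v ht⟩
    · simp [ht]
  · intro j t
    by_cases ht : 1 ≤ t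
    · simpa [ht] using h.u_nonneg j t ht
    · simp [ht]

/-- An infinite objective value does no harm here: only nonemptiness of the feasible set is needed.
-/
theorem exists_lpFeasible (I : GMSSC) : ∃ x u, I.LPFeasible x u := by
  refine ⟨0, 1, ?_, ?_, ?_, ?_⟩
  · simp
  · simp
  · simp
  · intro j t _ S _ _
    simp [prefixSum]

theorem exists_lpOptimal (I : GMSSC) : ∃ x u, I.LPOptimal x u := by
  set cube : Set ((Fin I.n → ℕ → ℝ) × (Fin I.m → ℕ → ℝ)) :=
    (Set.univ.pi fun _ => Set.univ.pi fun _ => Set.Icc 0 1) ×ˢ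
      (Set.univ.pi fun _ => Set.univ.pi fun _ => Set.Icc 0 1) with hcube
  have hmem : ∀ x u, (∀ v t, x v t ∈ Set.Icc (0 : ℝ) 1) → (∀ j t, u j t ∈ Set.Icc (0 : ℝ) 1) →
      (x, u) ∈ cube := fun x u hx hu =>
    ⟨fun v _ t _ => hx v t, fun j _ t _ => hu j t⟩
  have hcpt : IsCompact (cube ∩ {p | I.LPFeasible p.1 p.2}) :=
    ((isCompact_univ_pi fun _ => isCompact_univ_pi fun _ => isCompact_Icc).prod
      (isCompact_univ_pi fun _ => isCompact_univ_pi fun _ => isCompact_Icc)).inter_right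
      I.isClosed_lpFeasible
  have hne : (cube ∩ {p | I.LPFeasible p.1 p.2}).Nonempty := by
    obtain ⟨x, u, h⟩ := I.exists_lpFeasible
    obtain ⟨x', u', h', -, hx, hu⟩ := h.exists_mem_cube
    exact ⟨(x', u'), hmem _ _ hx hu, h'⟩
  obtain ⟨⟨x, u⟩, hxu, hmin⟩ := (I.lowerSemicontinuous_lpCost.lowerSemicontinuousOn _).exists_isMinOn
    hne hcpt
  refine ⟨x, u, hxu.2, fun x' u' h' => ?_⟩
  obtain ⟨x'', u'', h'', hle, hx, hu⟩ := h'.exists_mem_cube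
  exact (hmin (a := (x'', u'')) ⟨hmem _ _ hx hu, h''⟩).trans hle

/-! ### The linear program is a relaxation -/

/-- The integral schedule of an ordering. -/
def schedule (σ : I.Ordering) (v : Fin I.n) (t : ℕ) : ℝ := if t = σ.symm v + 1 then 1 else 0

/-- The indicator of the times at which a hyperedge is uncovered. -/
def uncovered (σ : I.Ordering) (j : Fin I.m) (t : ℕ) : ℝ := if t ≤ I.coverTime σ j then 1 else 0

theorem prefixSum_schedule (σ : I.Ordering) (v : Fin I.n) (t : ℕ) :
    prefixSum (schedule σ v) t = if (σ.symm v : ℕ) + 1 < t then 1 else 0 := by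
  simp [prefixSum, schedule, Finset.sum_ite_eq']

theorem lpFeasible_schedule (hI : I.IsMinLatency) (σ : I.Ordering) :
    I.LPFeasible (schedule σ) (uncovered σ) := by
  refine ⟨fun v t _ => ?_, fun j t _ => ?_, fun t ht => ?_, fun j t ht S hS hcard => ?_⟩
  · unfold schedule; split_ifs <;> simp
  · unfold uncovered; split_ifs <;> simp
  · simp only [schedule, ← Finset.sum_filter, Finset.sum_const, nsmul_eq_mul, mul_one]
    have : #{v | t = (σ.symm v : ℕ) + 1} ≤ 1 := by
      refine Finset.card_le_one.2 fun v hv w hw => ?_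
      simp only [mem_filter, mem_univ, true_and] at hv hw
      exact σ.symm.injective (Fin.ext (by omega))
    exact_mod_cast this
  · by_cases hu : t ≤ I.coverTime σ j
    · simp only [uncovered, hu, if_true, mul_one, le_add_iff_nonneg_right]
      refine Finset.sum_nonneg fun v _ => ?_
      rw [prefixSum_schedule]
      split_ifs <;> simp
    · have hone : ∀ v ∈ I.edge j \ S, prefixSum (schedule σ v) t = 1 := by
        intro v hv
        have := succ_le_coverTime hI σ (mem_sdiff.1 hv).1
        rw [prefixSum_schedule, if_pos (by omega)]
      rw [Finset.sum_congr rfl hone, Finset.sum_const, nsmul_eq_mul, mul_one,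
        Finset.cast_card_sdiff hS, ← hI j]
      simp [uncovered, hu]

theorem lpCost_uncovered (σ : I.Ordering) : I.lpCost (uncovered σ) = I.cost σ := by
  simp only [lpCost, cost, Nat.cast_sum]
  refine Finset.sum_congr rfl fun j _ => ?_
  rw [tsum_eq_sum (s := range (I.coverTime σ j))]
  · rw [Finset.sum_congr rfl (g := fun _ => 1)]
    · simp
    · intro t ht
      have : t + 1 ≤ I.coverTime σ j := mem_range.1 ht
      simp [uncovered, this]
  · intro t ht
    have : ¬ t + 1 ≤ I.coverTime σ j := fun h => ht (mem_range.2 h)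
    simp [uncovered, this]

theorem LPOptimal.lpCost_le_opt (hI : I.IsMinLatency) {x : Fin I.n → ℕ → ℝ}
    {u : Fin I.m → ℕ → ℝ} (h : I.LPOptimal x u) : I.lpCost u ≤ I.opt := by
  obtain ⟨σ, hσ⟩ := exists_cost_eq_opt I
  rw [← hσ, ← lpCost_uncovered σ]
  exact h.2 _ _ (lpFeasible_schedule hI σ)

/-! ### The transformed solution -/

theorem prefixSum_succ (f : ℕ → ℝ) {t : ℕ} (ht : 1 ≤ t) :
    prefixSum f (t + 1) = prefixSum f t + f t :=
  Finset.sum_Ico_succ_top ht f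

theorem transform_kernel (α : ℝ) (f : ℕ → ℝ) (t : ℕ) :
    transform (kernel α) f t = α / (t * (t + 1)) * ∑ s ∈ Icc 1 t, s * f s := by
  rw [transform, Finset.mul_sum]
  refine Finset.sum_congr rfl fun s hs => ?_
  rw [kernel, if_pos (mem_Icc.1 hs)]
  ring

/-- Summation by parts: `f r` is counted `t - r` times in the first sum and `r` times in the second.
-/
theorem sum_prefixSum_add (f : ℕ → ℝ) (t : ℕ) :
    ∑ s ∈ Icc 1 t, prefixSum f s + ∑ s ∈ Icc 1 t, s * f s = t * prefixSum f (t + 1) := by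
  induction t with
  | zero => simp
  | succ t ih =>
    rw [Finset.sum_Icc_succ_top (by omega), Finset.sum_Icc_succ_top (by omega),
      prefixSum_succ f (by omega : 1 ≤ t + 1)]
    push_cast
    linarith

/-- This identity explains the kernel: transformed prefix sums are `α` times running averages of the
original ones. -/
theorem mul_prefixSum_transform (α : ℝ) (f : ℕ → ℝ) {t : ℕ} (ht : 1 ≤ t) :
    t * prefixSum (transform (kernel α) f) t = α * ∑ s ∈ Icc 1 t, prefixSum f s := by
  induction t, ht using Nat.le_induction with
  | base => simp [prefixSum]
  | succ t ht ih =>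
    have h := sum_prefixSum_add f t
    have ht0 : (0 : ℝ) < t := by exact_mod_cast ht
    rw [prefixSum_succ _ ht, transform_kernel, Finset.sum_Icc_succ_top (by omega)]
    set W := ∑ s ∈ Icc 1 t, prefixSum f s
    set M := ∑ s ∈ Icc 1 t, (s : ℝ) * f s
    set Z := prefixSum (transform (kernel α) f) t
    have hM : M = t * prefixSum f (t + 1) - W := by linarith
    have hZ : Z = α * W / t := by field_simp; linarith
    rw [hM, hZ]
    push_cast
    field_simp
    ring

theorem transform_nonneg {α : ℝ} (hα : 0 ≤ α) {f : ℕ → ℝ} (hf : ∀ t, 1 ≤ t → 0 ≤ f t) (t : ℕ) :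
    0 ≤ transform (kernel α) f t := by
  rw [transform_kernel]
  have : 0 ≤ ∑ s ∈ Icc 1 t, (s : ℝ) * f s :=
    Finset.sum_nonneg fun s hs => mul_nonneg (Nat.cast_nonneg _) (hf s (mem_Icc.1 hs).1)
  positivity

theorem prefixSum_mono {f : ℕ → ℝ} (hf : ∀ t, 1 ≤ t → 0 ≤ f t) : Monotone (prefixSum f) :=
  fun _ _ h => Finset.sum_le_sum_of_subset_of_nonneg (Finset.Ico_subset_Ico_right h)
    fun s hs _ => hf s (mem_Ico.1 hs).1

theorem sum_Icc_cast (t : ℕ) : ∑ s ∈ Icc 1 t, (s : ℝ) = t * (t + 1) / 2 := by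
  induction t with
  | zero => simp
  | succ t ih =>
    rw [Finset.sum_Icc_succ_top (by omega), ih]
    push_cast
    ring

/-- The transformed solution schedules at most `α / 2` vertices at every time. -/
theorem LPFeasible.sum_transform_le {x : Fin I.n → ℕ → ℝ} {u : Fin I.m → ℕ → ℝ}
    (h : I.LPFeasible x u) {α : ℝ} (hα : 0 ≤ α) (t : ℕ) :
    ∑ v, transform (kernel α) (x v) t ≤ α / 2 := by
  rcases Nat.eq_zero_or_pos t with rfl | ht
  · simp [transform]; positivity
  simp only [transform_kernel, ← Finset.mul_sum]
  rw [Finset.sum_comm]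
  have h1 : ∑ s ∈ Icc 1 t, ∑ v, (s : ℝ) * x v s ≤ t * (t + 1) / 2 := by
    rw [← sum_Icc_cast]
    refine Finset.sum_le_sum fun s hs => ?_
    rw [← Finset.mul_sum]
    exact mul_le_of_le_one_right (Nat.cast_nonneg _) (h.capacity s (mem_Icc.1 hs).1)
  have ht0 : (0 : ℝ) < t := by exact_mod_cast ht
  calc _ ≤ α / (t * (t + 1)) * (t * (t + 1) / 2) := by gcongr
    _ = α / 2 := by field_simp

theorem LPFeasible.sum_prefixSum_transform_le {x : Fin I.n → ℕ → ℝ} {u : Fin I.m → ℕ → ℝ}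
    (h : I.LPFeasible x u) {α : ℝ} (hα : 0 ≤ α) {t : ℕ} (ht : 1 ≤ t) :
    ∑ v, prefixSum (transform (kernel α) (x v)) t ≤ α / 2 * (t - 1) := by
  simp only [prefixSum]
  rw [Finset.sum_comm]
  refine (Finset.sum_le_card_nsmul _ _ (α / 2) fun s _ => h.sum_transform_le hα s).trans_eq ?_
  rw [Nat.card_Ico, nsmul_eq_mul, Nat.cast_sub ht]
  push_cast
  ring

/-- This is the knapsack cover inequality for `S = e \ {v}`, where the residual demand is 1 because
the demand is all of `e`. -/
theorem LPFeasible.one_sub_le_prefixSum (hI : I.IsMinLatency) {x : Fin I.n → ℕ → ℝ}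
    {u : Fin I.m → ℕ → ℝ} (h : I.LPFeasible x u) {j : Fin I.m} {v : Fin I.n} (hv : v ∈ I.edge j)
    {t : ℕ} (ht : 1 ≤ t) : 1 - u j t ≤ prefixSum (x v) t := by
  have hcard : #((I.edge j).erase v) + 1 = I.demand j := by
    rw [Finset.card_erase_add_one hv, hI j]
  have key := h.knapsackCover j t ht _ (Finset.erase_subset v _) (by omega)
  have hone : (I.demand j : ℝ) - #((I.edge j).erase v) = 1 := by
    rw [← hcard]; push_cast; ring
  have hsdiff : I.edge j \ (I.edge j).erase v = {v} := by
    ext w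
    simp only [mem_sdiff, mem_erase, mem_singleton]
    constructor
    · rintro ⟨h1, h2⟩; by_contra h3; exact h2 ⟨h3, h1⟩
    · rintro rfl; exact ⟨hv, fun h => h.1 rfl⟩
  rw [hone, hsdiff, Finset.sum_singleton, one_mul] at key
  linarith

/-- The contribution of a hyperedge to the objective value. -/
def edgeCost (u : Fin I.m → ℕ → ℝ) (j : Fin I.m) : ℝ :=
  (∑' t : ℕ, ENNReal.ofReal (u j (t + 1))).toReal

theorem tsum_ne_top_of_lpCost {u : Fin I.m → ℕ → ℝ} (hu : I.lpCost u ≠ ⊤) (j : Fin I.m) :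
    ∑' t : ℕ, ENNReal.ofReal (u j (t + 1)) ≠ ⊤ :=
  (ENNReal.sum_ne_top.1 hu) j (mem_univ j)

theorem sum_edgeCost {u : Fin I.m → ℕ → ℝ} (hu : I.lpCost u ≠ ⊤) :
    ∑ j, edgeCost u j = (I.lpCost u).toReal :=
  (ENNReal.toReal_sum fun j _ => tsum_ne_top_of_lpCost hu j).symm

theorem LPFeasible.sum_le_edgeCost {x : Fin I.n → ℕ → ℝ} {u : Fin I.m → ℕ → ℝ}
    (h : I.LPFeasible x u) (hu : I.lpCost u ≠ ⊤) (j : Fin I.m) (t : ℕ) :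
    ∑ s ∈ Icc 1 t, u j s ≤ edgeCost u j := by
  have h1 : ∑ s ∈ Icc 1 t, u j s = ∑ s ∈ range t, u j (s + 1) := by
    rw [Finset.range_eq_Ico, Finset.sum_Ico_add' (fun s => u j s) 0 t 1]
    rfl
  rw [h1, edgeCost, ← ENNReal.ofReal_le_iff_le_toReal (tsum_ne_top_of_lpCost hu j),
    ENNReal.ofReal_sum_of_nonneg fun s _ => h.u_nonneg j (s + 1) (by omega)]
  exact ENNReal.sum_le_tsum _

/-- Nothing is scheduled before time 1, so `u` is at least 1 there. This makes the deadline
positive. -/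
theorem LPFeasible.one_le_edgeCost (hI : I.IsMinLatency) {x : Fin I.n → ℕ → ℝ}
    {u : Fin I.m → ℕ → ℝ} (h : I.LPFeasible x u) (hu : I.lpCost u ≠ ⊤) (j : Fin I.m) :
    1 ≤ edgeCost u j := by
  obtain ⟨v, hv⟩ := edge_nonempty j
  have h1 := h.one_sub_le_prefixSum hI hv le_rfl
  have h2 := h.sum_le_edgeCost hu j 1
  simp [prefixSum] at h1 h2
  linarith

/-- The time by which all vertices of a hyperedge have reached their thresholds. -/
def deadline (α : ℝ) (u : Fin I.m → ℕ → ℝ) (j : Fin I.m) : ℕ := ⌈α / (α - 1) * edgeCost u j⌉₊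

theorem LPFeasible.one_le_deadline (hI : I.IsMinLatency) {x : Fin I.n → ℕ → ℝ}
    {u : Fin I.m → ℕ → ℝ} (h : I.LPFeasible x u) (hu : I.lpCost u ≠ ⊤) {α : ℝ} (hα : 1 < α)
    (j : Fin I.m) : 1 ≤ deadline α u j := by
  have h1 := h.one_le_edgeCost hI hu j
  have h2 : 0 < α - 1 := by linarith
  exact Nat.one_le_ceil_iff.2 (by positivity)

/-- With `U` the edge cost and `T` the deadline, the prefix sums of `x v` up to `T` add up to at
least `T - U`. The transformed prefix sum is hence at least `α(T - U)/T`, and the deadline is chosen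
to make this at least 1. -/
theorem LPFeasible.one_le_prefixSum_transform (hI : I.IsMinLatency) {x : Fin I.n → ℕ → ℝ}
    {u : Fin I.m → ℕ → ℝ} (h : I.LPFeasible x u) (hu : I.lpCost u ≠ ⊤) {α : ℝ} (hα : 1 < α)
    {j : Fin I.m} {v : Fin I.n} (hv : v ∈ I.edge j) :
    1 ≤ prefixSum (transform (kernel α) (x v)) (deadline α u j) := by
  have hT := h.one_le_deadline hI hu hα j
  have hα1 : 0 < α - 1 := by linarith
  have hceil : α / (α - 1) * edgeCost u j ≤ deadline α u j := Nat.le_ceil _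
  set T := deadline α u j
  have hT0 : (0 : ℝ) < T := by exact_mod_cast hT
  have h1 := mul_prefixSum_transform α (x v) hT
  have h2 : (T : ℝ) - edgeCost u j ≤ ∑ s ∈ Icc 1 T, prefixSum (x v) s := by
    calc (T : ℝ) - edgeCost u j ≤ T - ∑ s ∈ Icc 1 T, u j s := by
          have := h.sum_le_edgeCost hu j T
          linarith
      _ = ∑ s ∈ Icc 1 T, (1 - u j s) := by simp
      _ ≤ _ := Finset.sum_le_sum fun s hs => h.one_sub_le_prefixSum hI hv (mem_Icc.1 hs).1
  have h3 : α * edgeCost u j ≤ (α - 1) * T := by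
    rw [div_mul_eq_mul_div, div_le_iff₀ hα1] at hceil
    linarith
  have h4 : (T : ℝ) * 1 ≤ T * prefixSum (transform (kernel α) (x v)) T := by
    rw [h1]
    have := mul_le_mul_of_nonneg_left h2 (by linarith : 0 ≤ α)
    linarith
  exact le_of_mul_le_mul_left h4 hT0

/-! ### The rounded ordering -/

theorem alphaPoint_le_of_le {z : ℕ → ℝ} {a : ℝ} {t : ℕ} (ht : 1 ≤ t) (h : a ≤ prefixSum z t) :
    alphaPoint z a ≤ t :=
  iInf₂_le t ⟨ht, h⟩

theorem le_prefixSum_of_alphaPoint_le {z : ℕ → ℝ} (hz : ∀ t, 1 ≤ t → 0 ≤ z t) {a : ℝ} {t : ℕ}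
    (h : alphaPoint z a ≤ t) : a ≤ prefixSum z t := by
  by_contra hlt
  have : ((t + 1 : ℕ) : ℕ∞) ≤ alphaPoint z a := by
    refine le_iInf₂ fun s hs => ?_
    have hts : t < s := by
      by_contra hst
      exact hlt (hs.2.trans (prefixSum_mono hz (not_lt.1 hst)))
    exact_mod_cast hts
  have := this.trans h
  norm_cast at this
  omega

theorem alphaPoint_mono (z : ℕ → ℝ) : Monotone (alphaPoint z) := fun _ _ hab =>
  le_iInf₂ fun t ht => iInf₂_le t ⟨ht.1, hab.trans ht.2⟩

/-- By monotonicity in the threshold, the preimage of each of the countably many values is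
order-connected, hence measurable. -/
theorem measurable_alphaPoint (z : ℕ → ℝ) : Measurable (alphaPoint z) :=
  measurable_to_countable' fun _ =>
    (Set.ordConnected_singleton.preimage_mono (alphaPoint_mono z)).measurableSet

/-- Whatever the tie-breaking, a vertex placed no later than `v` has a tentative time no larger than
that of `v`. -/
theorem coverTime_rounding_le (hI : I.IsMinLatency) (K : ℕ → ℕ → ℝ) (x : Fin I.n → ℕ → ℝ)
    (a : Fin I.n → ℝ) (π : Equiv.Perm (Fin I.n)) {j : Fin I.m} {T : ℕ}
    (hT : ∀ v ∈ I.edge j, alphaPoint (transform K (x v)) (a v) ≤ T) :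
    I.coverTime (I.rounding K x a π) j ≤
      #{w | alphaPoint (transform K (x w)) (a w) ≤ (T : ℕ∞)} := by
  refine (coverTime_le_iff hI _ _ _).2 fun v hv => ?_
  rw [← card_symm_le]
  refine Finset.card_le_card fun w hw => ?_
  simp only [mem_filter, mem_univ, true_and] at hw ⊢
  have hmono := Tuple.monotone_sort fun v => toLex (alphaPoint (transform K (x v)) (a v), π v)
  have hle := hmono hw
  simp only [rounding, Function.comp_apply, Equiv.apply_symm_apply] at hle
  refine le_trans ?_ (hT v hv)
  rw [Prod.Lex.toLex_le_toLex] at hle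
  rcases hle with h | h
  · exact h.le
  · exact h.1.le

theorem cost_le (hI : I.IsMinLatency) (σ : I.Ordering) : I.cost σ ≤ I.m * I.n := by
  refine (Finset.sum_le_card_nsmul _ _ I.n fun j _ => coverTime_le hI σ j).trans ?_
  simp

theorem averageCost_le_of_forall {K : ℕ → ℕ → ℝ} {x : Fin I.n → ℕ → ℝ} {a : Fin I.n → ℝ} {B : ℝ}
    (h : ∀ π, (I.cost (I.rounding K x a π) : ℝ) ≤ B) : I.averageCost K x a ≤ B := by
  rw [averageCost, div_le_iff₀ (by exact_mod_cast Nat.factorial_pos _)]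
  refine (Finset.sum_le_card_nsmul _ _ B fun π _ => h π).trans_eq ?_
  rw [Finset.card_univ, Fintype.card_perm, Fintype.card_fin, nsmul_eq_mul, mul_comm]

theorem averageCost_nonneg (K : ℕ → ℕ → ℝ) (x : Fin I.n → ℕ → ℝ) (a : Fin I.n → ℝ) :
    0 ≤ I.averageCost K x a := by
  unfold averageCost
  positivity

instance (I : GMSSC) : IsProbabilityMeasure I.thresholdLaw := by
  have : IsProbabilityMeasure ((volume : Measure ℝ).restrict (Set.Icc 0 1)) := ⟨by simp⟩
  unfold thresholdLaw
  infer_instance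

/-- The cost depends on the thresholds only through the tentative times, which take values in a
countable discrete space. -/
theorem measurable_averageCost (K : ℕ → ℕ → ℝ) (x : Fin I.n → ℕ → ℝ) :
    Measurable (I.averageCost K x) := by
  have h1 : Measurable fun (a : Fin I.n → ℝ) (v : Fin I.n) =>
      alphaPoint (transform K (x v)) (a v) :=
    measurable_pi_lambda _ fun v => (measurable_alphaPoint _).comp (measurable_pi_apply v)
  let g : (Fin I.n → ℕ∞) → ℝ := fun τ =>
    (∑ π : Equiv.Perm (Fin I.n),
      (I.cost (Tuple.sort fun v => toLex (τ v, π v) : I.Ordering) : ℝ)) / (I.n)!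
  exact (Measurable.of_discrete (f := g)).comp h1

theorem integrable_averageCost (hI : I.IsMinLatency) (K : ℕ → ℕ → ℝ) (x : Fin I.n → ℕ → ℝ) :
    Integrable (I.averageCost K x) I.thresholdLaw := by
  refine Integrable.of_bound (measurable_averageCost K x).aestronglyMeasurable (I.m * I.n : ℕ)
    (Filter.Eventually.of_forall fun a => ?_)
  rw [Real.norm_of_nonneg (averageCost_nonneg K x a)]
  exact averageCost_le_of_forall fun π => by exact_mod_cast cost_le hI _

theorem ae_mem_Icc (I : GMSSC) : ∀ᵐ a ∂I.thresholdLaw, ∀ v, a v ∈ Set.Icc (0 : ℝ) 1 := by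
  have : IsProbabilityMeasure ((volume : Measure ℝ).restrict (Set.Icc 0 1)) := ⟨by simp⟩
  rw [ae_all_iff]
  intro v
  exact (measurePreserving_eval (fun _ : Fin I.n => (volume : Measure ℝ).restrict (Set.Icc 0 1))
    v).quasiMeasurePreserving.ae (ae_restrict_mem measurableSet_Icc)

theorem thresholdLaw_real_le (I : GMSSC) (v : Fin I.n) {c : ℝ} (hc : 0 ≤ c) :
    I.thresholdLaw.real {a | a v ≤ c} ≤ c := by
  have : IsProbabilityMeasure ((volume : Measure ℝ).restrict (Set.Icc 0 1)) := ⟨by simp⟩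
  have h1 : I.thresholdLaw {a | a v ≤ c} ≤ ENNReal.ofReal c := by
    have := (measurePreserving_eval (fun _ : Fin I.n =>
      (volume : Measure ℝ).restrict (Set.Icc 0 1)) v).measure_preimage
      (measurableSet_Iic (a := c)).nullMeasurableSet
    refine (this.trans_le ?_ :)
    rw [Measure.restrict_apply measurableSet_Iic]
    refine (measure_mono (t := Set.Icc 0 c) fun y hy => ⟨hy.2.1, hy.1⟩).trans ?_
    simp
  exact ENNReal.toReal_le_of_le_ofReal hc h1

theorem LPOptimal.expectedCost_le (hI : I.IsMinLatency) {x : Fin I.n → ℕ → ℝ}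
    {u : Fin I.m → ℕ → ℝ} (h : I.LPOptimal x u) {α : ℝ} (hα : 1 < α) :
    I.expectedCost (kernel α) x ≤ α ^ 2 / (2 * (α - 1)) * I.opt := by
  have hα0 : 0 ≤ α := by linarith
  have hα1 : 0 < α - 1 := by linarith
  have hopt := h.lpCost_le_opt hI
  have hu : I.lpCost u ≠ ⊤ := ne_top_of_le_ne_top (ENNReal.natCast_ne_top _) hopt
  have hf := h.1
  set Z : Fin I.n → Fin I.m → ℝ := fun w j =>
    prefixSum (transform (kernel α) (x w)) (deadline α u j) with hZ
  have hz : ∀ w t, 1 ≤ t → 0 ≤ transform (kernel α) (x w) t := fun w t _ =>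
    transform_nonneg hα0 (hf.x_nonneg w) t
  have hmeas : ∀ w c, MeasurableSet {a : Fin I.n → ℝ | a w ≤ c} := fun w c =>
    measurableSet_le (measurable_pi_apply w) measurable_const
  have hint : ∀ w c, Integrable ({a : Fin I.n → ℝ | a w ≤ c}.indicator fun _ => (1 : ℝ))
      I.thresholdLaw := fun w c => (integrable_const 1).indicator (hmeas w c)
  -- All vertices of `j` meet the deadline for almost every choice of thresholds; only the number of
  -- other vertices that meet it is random. Linearity of expectation then reduces the estimate to
  -- the marginal laws.
  have hbound : ∀ᵐ a ∂I.thresholdLaw, I.averageCost (kernel α) x a ≤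
      ∑ j, ∑ w, {a : Fin I.n → ℝ | a w ≤ Z w j}.indicator (fun _ => (1 : ℝ)) a := by
    filter_upwards [I.ae_mem_Icc] with a ha
    refine averageCost_le_of_forall fun π => ?_
    rw [cost, Nat.cast_sum]
    refine Finset.sum_le_sum fun j _ => ?_
    have h1 := coverTime_rounding_le hI (kernel α) x a π (j := j) (T := deadline α u j)
      fun v hv => alphaPoint_le_of_le (hf.one_le_deadline hI hu hα j)
        ((ha v).2.trans (hf.one_le_prefixSum_transform hI hu hα hv))
    have h2 : #{w | alphaPoint (transform (kernel α) (x w)) (a w) ≤ (deadline α u j : ℕ∞)} ≤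
        #{w | a w ≤ Z w j} := by
      refine Finset.card_le_card fun w hw => ?_
      simp only [mem_filter, mem_univ, true_and] at hw ⊢
      exact le_prefixSum_of_alphaPoint_le (hz w) hw
    refine (Nat.cast_le.2 (h1.trans h2)).trans_eq ?_
    simp [Set.indicator_apply]
  calc I.expectedCost (kernel α) x
      ≤ ∫ a, ∑ j, ∑ w, {a : Fin I.n → ℝ | a w ≤ Z w j}.indicator (fun _ => (1 : ℝ)) a
          ∂I.thresholdLaw :=
        integral_mono_ae (integrable_averageCost hI _ _)
          (integrable_finsetSum _ fun j _ => integrable_finsetSum _ fun w _ => hint w _) hbound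
    _ = ∑ j, ∑ w, I.thresholdLaw.real {a | a w ≤ Z w j} := by
        rw [integral_finsetSum _ fun j _ => integrable_finsetSum _ fun w _ => hint w _]
        refine Finset.sum_congr rfl fun j _ => ?_
        rw [integral_finsetSum _ fun w _ => hint w _]
        refine Finset.sum_congr rfl fun w _ => ?_
        rw [integral_indicator (hmeas w _)]
        simp
    _ ≤ ∑ j, ∑ w, Z w j := Finset.sum_le_sum fun j _ => Finset.sum_le_sum fun w _ =>
        I.thresholdLaw_real_le w (prefixSum_nonneg (hz w) _)
    _ ≤ ∑ j, α ^ 2 / (2 * (α - 1)) * edgeCost u j := by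
        refine Finset.sum_le_sum fun j _ => ?_
        refine (hf.sum_prefixSum_transform_le hα0 (hf.one_le_deadline hI hu hα j)).trans ?_
        have h1 := hf.one_le_edgeCost hI hu j
        have h2 : (deadline α u j : ℝ) < α / (α - 1) * edgeCost u j + 1 :=
          Nat.ceil_lt_add_one (by positivity)
        -- Prefix sums stop strictly before the deadline, and the resulting `-1` cancels the loss
        -- from rounding up.
        calc α / 2 * ((deadline α u j : ℝ) - 1) ≤ α / 2 * (α / (α - 1) * edgeCost u j) := by
              gcongr
              linarith
          _ = _ := by field_simp
    _ = α ^ 2 / (2 * (α - 1)) * (I.lpCost u).toReal := by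
        rw [← Finset.mul_sum, sum_edgeCost hu]
    _ ≤ α ^ 2 / (2 * (α - 1)) * I.opt := by
        gcongr
        exact ENNReal.toReal_le_of_le_ofReal (Nat.cast_nonneg _) (by simpa using hopt)

end GMSSC

end

theorem theorem2 :
    (∃ p : RAM.Program, RAM.IsMinLatencyApprox p 2) ∧
    (∀ I : GMSSC, I.IsMinLatency →
      (∃ x u, I.LPOptimal x u) ∧
      (∀ x u, I.LPOptimal x u →
        (∀ α : ℝ, 2 ≤ α →
          Integrable (I.averageCost (GMSSC.kernel α) x) I.thresholdLaw ∧
          I.expectedCost (GMSSC.kernel α) x ≤ α ^ 2 / (2 * (α - 1)) * I.opt) ∧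
        I.expectedCost (GMSSC.kernel 2) x ≤ 2 * I.opt)) := by
  refine ⟨⟨_, RAM.isMinLatencyApprox_balanceAndSort⟩, fun I hI => ⟨I.exists_lpOptimal,
    fun x u h => ⟨fun α hα => ⟨GMSSC.integrable_averageCost hI _ _,
      h.expectedCost_le hI (by linarith)⟩, ?_⟩⟩⟩
  have := h.expectedCost_le hI (α := 2) (by norm_num)
  norm_num at this
  exact this
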